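/- Conventions. A vertex algebra over $\mathbb C$ has vertex operators $Y(u,x)=\sum_{n\in\mathbb Z}u_nx^{-n-1}$, $u_n\in\operatorname{End}V$. A vertex operator algebra $V$ is a vertex algebra with a conformal vector $\omega$ whose modes $L(n)=\omega_{n+1}$ satisfy the Virasoro relations for some central charge and $Y(L(-1)u,x)=\frac{d}{dx}Y(u,x)$, and such that $V=\bigoplus_{n\in\mathbb Z}V_{(n)}$, where $V_{(n)}=\{u: L(0)u=nu\}$ is finite-dimensional for all $n$ and zero for $n$ sufficiently negative. A linear operator on $V$ is locally finite if every vector lies in a finite-dimensional invariant subspace. Put $R=\mathbb C((z))$, $\partial=d/dz$. On $V\otimes R$ consider the tensor product vertex algebra $V\otimes(R,\partial)$, with vacuum $\mathbf 1\otimes 1$ and $$Y(u\otimes a,x)(w\otimes b)=Y(u,x)w\otimes(e^{x\partial}a)b .$$ A $\mathbb C((z))$-valued pseudo-endomorphism of $V$ is a linear map $\Delta:V\to V\otimes R$ with $\Delta(\mathbf 1)=\mathbf 1\otimes 1$ and $\Delta Y(u,x)w=Y(e^{x(1\otimes\partial)}\Delta(u),x)\Delta(w)$ for $u,w\in V$,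 where on the right-hand side $Y$ is extended $R$-bilinearly by $Y(u\otimes a,x)(w\otimes b)=Y(u,x)w\otimes ab$. It is a pseudo-automorphism if its $R$-linear extension $V\otimes R\to V\otimes R$ is an automorphism of the vertex algebra $V\otimes(R,\partial)$, i.e. bijective, fixing the vacuum and compatible with vertex operators. For $v\in V$, $f\in R$ let $$X_{v,f}=\sum_{n\ge 0}\frac{1}{n!}(\partial^nf)\,v_n:\ V\to V\otimes\mathbb C((z)).$$ Proposition 3.13. Let $V$ be a vertex operator algebra and let $v\in V$ be homogeneous of positive integral weight $k$ (that is, $L(0)v=kv$) such that $[v_m,v_n]=0$ for all $m,n\ge 0$. Suppose that $v_0,v_1,\dots,v_{k-1}$ are locally finite on $V$, and let $f\in z^k\mathbb C[[z]]$. Then $\exp X_{v,f}=\sum_{n\ge 0}\frac1{n!}X_{v,f}^n$ exists in $\operatorname{Hom}(V,V\otimes\mathbb C((z)))$, and it is a $\mathbb C((z))$-valued pseudo-automorphism of $V$. Here powers are taken of the $\mathbb C((z))$-linear extension of $X_{v,f}$, and existence means that there is a linear map $E:V\to V\otimes\mathbb C((z))$ such that for every $w\in V$ there is a finite-dimensional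 subspace $U\subset V$ with the property that for every $M\in\mathbb Z$, $$E(w)-\sum_{n<N}\frac1{n!}X_{v,f}^n(w)\in U\otimes z^M\mathbb C[[z]]\quad\text{for all sufficiently large }N;$$ this $E$ is $\exp X_{v,f}$. -/

import Mathlib

open scoped TensorProduct LaurentSeries VertexOperator

noncomputable section

/-! ### The formal derivative on Laurent series as a derivation -/

/-- The `ℂ`-algebra structure on `ℂ((z))` whose scalar action is coefficientwise (Mathlib has two
propositionally equal ones; this fixes the choice). -/
instance laurentAlgebra : Algebra ℂ ℂ⸨X⸩ := HahnSeries.instAlgebra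

/-- The Euler operator `z d/dz` on `ℂ((z))`. -/
def laurentEuler (x : ℂ⸨X⸩) : ℂ⸨X⸩ where
  coeff n := (n : ℂ) * x.coeff n
  isPWO_support' := x.isPWO_support.mono fun n hn => by
    simp only [Function.mem_support] at hn
    exact right_ne_zero_of_mul hn

theorem laurentEuler_mul (x y : ℂ⸨X⸩) :
    laurentEuler (x * y) = x * laurentEuler y + laurentEuler x * y := by
  ext n
  have h : ∀ w : ℂ⸨X⸩, (laurentEuler w).support ⊆ w.support := fun w m hm => by
    simp only [HahnSeries.mem_support] at hm ⊢
    exact right_ne_zero_of_mul hm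
  rw [HahnSeries.coeff_add, HahnSeries.coeff_mul_left' x.isPWO_support (h x),
    HahnSeries.coeff_mul_right' y.isPWO_support (h y)]
  change (n : ℂ) * (x * y).coeff n = _
  rw [HahnSeries.coeff_mul, Finset.mul_sum, ← Finset.sum_add_distrib]
  refine Finset.sum_congr rfl fun p hp => ?_
  have hp' : p.1 + p.2 = n := (Finset.mem_antidiagonal.1 hp).2.2
  change _ = x.coeff p.1 * ((p.2 : ℂ) * y.coeff p.2) + (p.1 : ℂ) * x.coeff p.1 * y.coeff p.2
  rw [← hp']
  push_cast
  ring

theorem laurentDerivative_eq (x : ℂ⸨X⸩) :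
    LaurentSeries.derivative ℂ x = HahnSeries.single (-1 : ℤ) (1 : ℂ) * laurentEuler x := by
  ext n
  rw [HahnSeries.coeff_single_mul, LaurentSeries.derivative_apply,
    LaurentSeries.hasseDeriv_coeff]
  simp [laurentEuler]

/-- The derivation `d/dz` of the algebra `ℂ((z))`. -/
def laurentDerivation : Derivation ℂ ℂ⸨X⸩ ℂ⸨X⸩ :=
  Derivation.mk' (LaurentSeries.derivative ℂ) fun a b => by
    simp only [laurentDerivative_eq, laurentEuler_mul, smul_eq_mul]
    ring

/-- The subspace `z ^ m ℂ[[z]]` of `ℂ((z))`. -/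
def zPowSubspace (m : ℤ) : Submodule ℂ ℂ⸨X⸩ where
  carrier := {g | ∀ n < m, g.coeff n = 0}
  add_mem' ha hb n hn := by simp [ha n hn, hb n hn]
  zero_mem' n _ := by simp
  smul_mem' c a ha n hn := by simp [ha n hn]

/-! ### Vertex algebras -/

/-- The data of a vertex algebra over `ℂ`: a vacuum vector and a vertex operator map
`Y : V → Hom(V, V((x)))`. -/
structure VertexData (V : Type*) [AddCommGroup V] [Module ℂ V] where
  /-- the vacuum vector -/
  vac : V
  /-- the vertex operator map -/
  Y : V →ₗ[ℂ] VertexOperator ℂ V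

namespace VertexData

variable {V : Type*} [AddCommGroup V] [Module ℂ V]

/-- The mode `u_n`, where `Y(u,x) = ∑ u_n x^(-n-1)`. -/
def mode (A : VertexData V) (u : V) (n : ℤ) : Module.End ℂ V := (A.Y u)[[n]]

theorem mode_add (A : VertexData V) (u u' : V) (n : ℤ) :
    A.mode (u + u') n = A.mode u n + A.mode u' n := by
  simp [mode]

theorem mode_smul (A : VertexData V) (c : ℂ) (u : V) (n : ℤ) :
    A.mode (c • u) n = c • A.mode u n := by
  simp [mode]

theorem exists_mode_eq_zero (A : VertexData V) (u w : V) :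
    ∃ N : ℤ, ∀ n ≥ N, A.mode u n w = 0 := by
  refine ⟨-((HahnModule.of ℂ).symm (A.Y u w)).order, fun n hn => ?_⟩
  exact VertexOperator.ncoeff_eq_zero_of_lt_order _ _ _ (by lia)

/-- An automorphism of a vertex algebra: a bijective linear map `σ` with `σ(1) = 1` and
`σ(u_n v) = σ(u)_n σ(v)` for all `u`, `v`, `n`. -/
structure IsAutomorphism (A : VertexData V) (σ : V →ₗ[ℂ] V) : Prop where
  bijective : Function.Bijective σ
  map_vac : σ A.vac = A.vac
  map_mode : ∀ (u v : V) (n : ℤ), σ (A.mode u n v) = A.mode (σ u) n (σ v)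

end VertexData

/-- A vertex algebra over `ℂ`. The Jacobi identity is written in components (the coefficients of
`x₀^(-l-1) x₁^(-m-1) x₂^(-n-1)`). -/
structure VertexAlgebra (V : Type*) [AddCommGroup V] [Module ℂ V] extends VertexData V where
  /-- `Y(1,x) = id` -/
  vac_mode : ∀ (n : ℤ) (v : V), toVertexData.mode vac n v = if n = -1 then v else 0
  /-- `Y(v,x)1` has no pole -/
  mode_vac_of_nonneg : ∀ (v : V) (n : ℤ), 0 ≤ n → toVertexData.mode v n vac = 0
  /-- `Y(v,x)1` has constant term `v` -/
  mode_vac_neg_one : ∀ v : V, toVertexData.mode v (-1) vac = v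
  jacobi : ∀ (u v w : V) (l m n : ℤ),
    ∑ᶠ i : ℕ, Ring.choose m i •
        toVertexData.mode (toVertexData.mode u (l + i) v) (m + n - i) w =
      ∑ᶠ i : ℕ, ((-1 : ℤ) ^ i * Ring.choose l i) •
        (toVertexData.mode u (m + l - i) (toVertexData.mode v (n + i) w) -
          (-1 : ℂ) ^ l • toVertexData.mode v (n + l - i) (toVertexData.mode u (m + i) w))

/-- A (`ℤ`-graded) vertex operator algebra over `ℂ`; the weight spaces are the eigenspaces of
`L(0)`, where `L(n) = ω_{n+1}`. -/
structure VertexOperatorAlgebra (V : Type*) [AddCommGroup V] [Module ℂ V] extends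
    VertexAlgebra V where
  /-- the conformal vector -/
  conf : V
  /-- the central charge -/
  centralCharge : ℂ
  virasoro : ∀ m n : ℤ,
    ⁅toVertexData.mode conf (m + 1), toVertexData.mode conf (n + 1)⁆ =
      ((m : ℂ) - n) • toVertexData.mode conf (m + n + 1) +
        (if m + n = 0 then ((m : ℂ) ^ 3 - m) / 12 * centralCharge else 0) •
          (1 : Module.End ℂ V)
  /-- `Y(L(-1)v,x) = (d/dx) Y(v,x)` -/
  translation : ∀ (v : V) (n : ℤ),
    toVertexData.mode (toVertexData.mode conf 0 v) n = (-n : ℂ) • toVertexData.mode v (n - 1)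
  /-- `V` is the direct sum of the weight spaces with integral weight -/
  grading : DirectSum.IsInternal fun n : ℤ =>
    Module.End.eigenspace (toVertexData.mode conf 1) (n : ℂ)
  finiteDimensional : ∀ n : ℤ,
    FiniteDimensional ℂ (Module.End.eigenspace (toVertexData.mode conf 1) (n : ℂ))
  bounded_below : ∃ N : ℤ, ∀ n < N,
    Module.End.eigenspace (toVertexData.mode conf 1) (n : ℂ) = ⊥

/-- The weight space `V_(n)`. -/
def VertexOperatorAlgebra.weightSpace {V : Type*} [AddCommGroup V] [Module ℂ V]
    (A : VertexOperatorAlgebra V) (n : ℤ) : Submodule ℂ V :=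
  Module.End.eigenspace (A.mode A.conf 1) (n : ℂ)

/-- A linear operator is locally finite if every vector lies in a finite-dimensional invariant
subspace. -/
def IsLocallyFiniteOperator {V : Type*} [AddCommGroup V] [Module ℂ V] (T : Module.End ℂ V) :
    Prop :=
  ∀ w : V, ∃ U : Submodule ℂ V, FiniteDimensional ℂ U ∧ w ∈ U ∧ ∀ u ∈ U, T u ∈ U

/-! ### The tensor product with a differential algebra -/

section Tensor

variable {V : Type*} [AddCommGroup V] [Module ℂ V]
variable {R : Type*} [CommRing R] [Algebra ℂ R]

/-- `(1/j!) ∂^j`, the coefficient of `x^j` in `exp(x∂)`. -/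
def dividedPower (D : Derivation ℂ R R) (j : ℕ) : R →ₗ[ℂ] R :=
  (j.factorial : ℂ)⁻¹ • (D : R →ₗ[ℂ] R) ^ j

/-- The `n`-th mode of the `R`-bilinear extension of `Y`, i.e. of
`Y(u ⊗ a, x)(v ⊗ b) = Y(u,x)v ⊗ ab`. -/
def VertexData.scalarMode (A : VertexData V) (R : Type*) [CommRing R] [Algebra ℂ R] (n : ℤ) :
    V ⊗[ℂ] R →ₗ[ℂ] V ⊗[ℂ] R →ₗ[ℂ] V ⊗[ℂ] R :=
  TensorProduct.map₂
    (LinearMap.mk₂ ℂ (fun u v => A.mode u n v)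
      (fun u u' v => by simp [A.mode_add]) (fun c u v => by simp [A.mode_smul])
      (fun u v v' => by simp) (fun c u v => by simp))
    (LinearMap.mul ℂ R)

theorem VertexData.scalarMode_tmul (A : VertexData V) (n : ℤ) (u v : V) (a b : R) :
    A.scalarMode R n (u ⊗ₜ a) (v ⊗ₜ b) = A.mode u n v ⊗ₜ (a * b) := by
  simp [VertexData.scalarMode, TensorProduct.map₂_apply_tmul]

theorem VertexData.exists_scalarMode_eq_zero (A : VertexData V) (x y : V ⊗[ℂ] R) :
    ∃ N : ℤ, ∀ (T : R →ₗ[ℂ] R), ∀ n ≥ N, A.scalarMode R n (T.lTensor V x) y = 0 := by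
  induction x with
  | zero => exact ⟨0, by simp⟩
  | add x x' hx hx' =>
    obtain ⟨N, hN⟩ := hx
    obtain ⟨N', hN'⟩ := hx'
    refine ⟨max N N', fun T n hn => ?_⟩
    simp [hN T n (le_trans (le_max_left _ _) hn), hN' T n (le_trans (le_max_right _ _) hn)]
  | tmul u a =>
    induction y with
    | zero => exact ⟨0, by simp⟩
    | add y y' hy hy' =>
      obtain ⟨N, hN⟩ := hy
      obtain ⟨N', hN'⟩ := hy'
      refine ⟨max N N', fun T n hn => ?_⟩
      rw [map_add, hN T n (le_trans (le_max_left _ _) hn),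
        hN' T n (le_trans (le_max_right _ _) hn), add_zero]
    | tmul v b =>
      obtain ⟨N, hN⟩ := A.exists_mode_eq_zero u v
      refine ⟨N, fun T n hn => ?_⟩
      rw [LinearMap.lTensor_tmul, A.scalarMode_tmul, hN n hn, TensorProduct.zero_tmul]

/-- The terms whose sum over `j` is the coefficient of `x^(-n-1)` in
`Y(exp(x(1 ⊗ ∂)) p, x) q`. -/
def VertexData.expModeTerm (A : VertexData V) (D : Derivation ℂ R R) (n : ℤ) (j : ℕ)
    (p q : V ⊗[ℂ] R) : V ⊗[ℂ] R :=
  A.scalarMode R (n + j) ((dividedPower D j).lTensor V p) q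

theorem VertexData.finite_expModeTerm (A : VertexData V) (D : Derivation ℂ R R) (n : ℤ)
    (p q : V ⊗[ℂ] R) : (Function.support fun j : ℕ => A.expModeTerm D n j p q).Finite := by
  obtain ⟨N, hN⟩ := A.exists_scalarMode_eq_zero p q
  refine (Set.finite_Iio (N - n).toNat).subset fun j hj => ?_
  by_contra hlt
  exact hj (hN _ _ (by simp only [Set.mem_Iio] at hlt; lia))

/-- The coefficient of `x^(-n-1)` in `Y(exp(x(1 ⊗ ∂)) p, x) q`, for `p`, `q` in `V ⊗ R`. On pure
tensors this is the coefficient of `x^(-n-1)` in `Y(u,x)v ⊗ (exp(x∂)a) b`. -/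
def VertexData.expMode (A : VertexData V) (D : Derivation ℂ R R) (n : ℤ) :
    V ⊗[ℂ] R →ₗ[ℂ] V ⊗[ℂ] R →ₗ[ℂ] V ⊗[ℂ] R :=
  LinearMap.mk₂ ℂ (fun p q => ∑ᶠ j : ℕ, A.expModeTerm D n j p q)
    (fun p p' q => by
      rw [← finsum_add_distrib (A.finite_expModeTerm D n p q) (A.finite_expModeTerm D n p' q)]
      simp [VertexData.expModeTerm])
    (fun c p q => by
      rw [smul_finsum]
      simp [VertexData.expModeTerm])
    (fun p q q' => by
      rw [← finsum_add_distrib (A.finite_expModeTerm D n p q) (A.finite_expModeTerm D n p q')]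
      simp [VertexData.expModeTerm])
    (fun c p q => by
      rw [smul_finsum]
      simp [VertexData.expModeTerm])

theorem VertexData.expMode_tmul (A : VertexData V) (D : Derivation ℂ R R) (n : ℤ)
    (u v : V) (a b : R) :
    A.expMode D n (u ⊗ₜ a) (v ⊗ₜ b) =
      ∑ᶠ j : ℕ, A.mode u (n + j) v ⊗ₜ[ℂ] (dividedPower D j a * b) := by
  simp [VertexData.expMode, VertexData.expModeTerm, VertexData.scalarMode_tmul]

theorem VertexData.bddBelow_expMode (A : VertexData V) (D : Derivation ℂ R R)
    (p q : V ⊗[ℂ] R) :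
    BddBelow (Function.support fun n : ℤ => A.expMode D (-n - 1) p q) := by
  obtain ⟨N, hN⟩ := A.exists_scalarMode_eq_zero p q
  refine ⟨-N, fun n hn => ?_⟩
  by_contra hlt
  refine hn ?_
  change ∑ᶠ j : ℕ, A.expModeTerm D (-n - 1) j p q = 0
  rw [← finsum_zero (M := V ⊗[ℂ] R) (α := ℕ)]
  exact finsum_congr fun j => hN _ _ (by lia)

/-- The tensor product vertex algebra `V ⊗ (R,∂)`: its vacuum is `1 ⊗ 1` and
`Y(u ⊗ a, x)(v ⊗ b) = Y(u,x)v ⊗ (exp(x∂)a) b`. -/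
def VertexData.tensor (A : VertexData V) (D : Derivation ℂ R R) : VertexData (V ⊗[ℂ] R) where
  vac := A.vac ⊗ₜ 1
  Y :=
    { toFun := fun p => VertexOperator.of_coeff (fun n => A.expMode D (-n - 1) p)
        (A.bddBelow_expMode D p)
      map_add' := fun p p' => by
        apply HVertexOperator.coeff_inj
        ext n q
        simp
      map_smul' := fun c p => by
        apply HVertexOperator.coeff_inj
        ext n q
        simp }

theorem VertexData.tensor_mode (A : VertexData V) (D : Derivation ℂ R R) (p q : V ⊗[ℂ] R)
    (n : ℤ) : (A.tensor D).mode p n q = A.expMode D n p q := by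
  simp [VertexData.mode, VertexData.tensor]

/-- The `R`-linear extension `V ⊗ R → V ⊗ R` of `Φ : V → V ⊗ R`, sending `v ⊗ a` to `Φ(v) a`. -/
def scalarExtension (Φ : V →ₗ[ℂ] V ⊗[ℂ] R) : Module.End ℂ (V ⊗[ℂ] R) :=
  (LinearMap.mul' ℂ R).lTensor V ∘ₗ (TensorProduct.assoc ℂ V R R).toLinearMap ∘ₗ Φ.rTensor R

/-- `R`-valued pseudo-endomorphisms: `Δ(1) = 1 ⊗ 1` and
`Δ(Y(u,x)v) = Y(exp(x(1 ⊗ ∂)) Δ(u), x) Δ(v)`. -/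
structure VertexData.IsPseudoEndomorphism (A : VertexData V) (D : Derivation ℂ R R)
    (Δ : V →ₗ[ℂ] V ⊗[ℂ] R) : Prop where
  map_vac : Δ A.vac = A.vac ⊗ₜ 1
  map_mode : ∀ (u v : V) (n : ℤ), Δ (A.mode u n v) = A.expMode D n (Δ u) (Δ v)

/-- `R`-valued pseudo-automorphisms: pseudo-endomorphisms whose `R`-linear extension is an
automorphism of the vertex algebra `V ⊗ (R,∂)`. -/
structure VertexData.IsPseudoAutomorphism (A : VertexData V) (D : Derivation ℂ R R)
    (Δ : V →ₗ[ℂ] V ⊗[ℂ] R) : Prop extends A.IsPseudoEndomorphism D Δ where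
  isAutomorphism : (A.tensor D).IsAutomorphism (scalarExtension Δ)

theorem VertexData.finite_pseudoDer (A : VertexData V) (D : Derivation ℂ R R) (v : V) (f : R)
    (w : V) :
    (Function.support fun n : ℕ => A.mode v n w ⊗ₜ[ℂ] dividedPower D n f).Finite := by
  obtain ⟨N, hN⟩ := A.exists_mode_eq_zero v w
  refine (Set.finite_Iio N.toNat).subset fun n hn => ?_
  by_contra hlt
  simp only [Set.mem_Iio] at hlt
  refine hn ?_
  change A.mode v n w ⊗ₜ[ℂ] dividedPower D n f = 0
  rw [hN n (by lia), TensorProduct.zero_tmul]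

/-- `X_{v,f} = ∑_{n ≥ 0} (1/n!) (∂^n f) v_n : V → V ⊗ R`. -/
def VertexData.pseudoDer (A : VertexData V) (D : Derivation ℂ R R) (v : V) (f : R) :
    V →ₗ[ℂ] V ⊗[ℂ] R where
  toFun w := ∑ᶠ n : ℕ, A.mode v n w ⊗ₜ[ℂ] dividedPower D n f
  map_add' w w' := by
    rw [← finsum_add_distrib (A.finite_pseudoDer D v f w) (A.finite_pseudoDer D v f w')]
    simp [TensorProduct.add_tmul]
  map_smul' c w := by
    rw [RingHom.id_apply, smul_finsum]
    simp [TensorProduct.smul_tmul']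

end Tensor

/-- `E = exp Φ` in `Hom(V, V ⊗ ℂ((z)))`: for every `w`, the series `∑_{n ≥ 0} Φ^n(w) / n!` (the
powers being those of the `ℂ((z))`-linear extension of `Φ`) converges to `E w` in the `z`-adic
topology of `U ⊗ ℂ((z))` for some finite-dimensional subspace `U` of `V`. -/
def IsFormalExp {V : Type*} [AddCommGroup V] [Module ℂ V] (Φ E : V →ₗ[ℂ] V ⊗[ℂ] ℂ⸨X⸩) : Prop :=
  ∀ w : V, ∃ U : Submodule ℂ V, FiniteDimensional ℂ U ∧
    ∀ M : ℤ, ∃ N₀ : ℕ, ∀ N ≥ N₀,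
      E w - ∑ n ∈ Finset.range N,
          (n.factorial : ℂ)⁻¹ • (scalarExtension Φ ^ n) (w ⊗ₜ[ℂ] (1 : ℂ⸨X⸩)) ∈
        Submodule.map₂ (TensorProduct.mk ℂ V ℂ⸨X⸩) U (zPowSubspace M)

end

/-! ### Divided powers of a derivation -/

section DividedPower

variable {R : Type*} [CommRing R] [Algebra ℂ R] (D : Derivation ℂ R R)

/-! Write X for `pseudoDer`. By the commutator formula, the R-linear extension of X is a derivation
of all products of V ⊗ (R, ∂), and X kills the vacuum (`pseudoDer_mode`, `pseudoDer_vac`). So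
formally exp X is a homomorphism with inverse exp(-X), and the real issue is convergence.

Two estimates give it. First, w lies in a finite-dimensional U stable under every v_n with n ≥ 0
(`exists_fg_invariant`): the modes with n ≥ k lower weights, so they preserve the finite-dimensional
space of weights at most H, and v_0, ..., v_{k-1} are then adjoined one at a time, commutativity
preserving the stability already reached. Second, v_j shifts weight by k - j - 1 while ∂^j f has
order at least k - j, so each application of X raises "order minus weight" by one
(`scalarExtension_pseudoDer_mem_weightFiltration`). Weights are bounded below, hence X^n(u ⊗ 1) lies
in U ⊗ z^(n-C) ℂ[[z]]. This is `IsContractedBy`; the homomorphism and inverse identities then follow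
by comparing truncated series at this linear rate. -/

theorem derivation_pow_mul (n : ℕ) (a b : R) :
    ((D : R →ₗ[ℂ] R) ^ n) (a * b) = ∑ p ∈ Finset.HasAntidiagonal.antidiagonal n,
      n.choose p.1 • (((D : R →ₗ[ℂ] R) ^ p.1) a * ((D : R →ₗ[ℂ] R) ^ p.2) b) := by
  induction n with
  | zero => simp
  | succ n ih =>
    -- Pascal's rule gives two sums over the same antidiagonal, one with its binomial indexed by the
    -- second entry; hence the appeal to symmetry below.
    rw [Finset.sum_antidiagonal_choose_succ_nsmul
      (fun i j => ((D : R →ₗ[ℂ] R) ^ i) a * ((D : R →ₗ[ℂ] R) ^ j) b) n,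
      pow_succ', Module.End.mul_apply, ih, map_sum, ← Finset.sum_add_distrib]
    refine Finset.sum_congr rfl fun p hp => ?_
    rw [map_nsmul, ← Nat.choose_symm_of_eq_add (Finset.HasAntidiagonal.mem_antidiagonal.1 hp).symm,
      pow_succ', pow_succ', Module.End.mul_apply, Module.End.mul_apply, ← nsmul_add]
    congr 1
    simp only [Derivation.coeFn_coe, Derivation.leibniz, smul_eq_mul]
    ring

theorem dividedPower_apply (n : ℕ) (a : R) :
    dividedPower D n a = (n.factorial : ℂ)⁻¹ • ((D : R →ₗ[ℂ] R) ^ n) a := rfl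

theorem dividedPower_zero (a : R) : dividedPower D 0 a = a := by
  simp [dividedPower_apply]

theorem dividedPower_one (n : ℕ) : dividedPower D n 1 = if n = 0 then 1 else 0 := by
  cases n with
  | zero => simp [dividedPower_apply]
  | succ n => simp [dividedPower_apply, pow_succ]

/-- The factorials absorb the binomial coefficients: exp(x∂) is multiplicative. The indexing by i
and n - i fits `Finset.sum_range_diag_flip`. -/
theorem dividedPower_mul (n : ℕ) (a b : R) :
    dividedPower D n (a * b) =
      ∑ i ∈ Finset.range (n + 1), dividedPower D i a * dividedPower D (n - i) b := by
  rw [← Nat.succ_eq_add_one, ← Finset.Nat.sum_antidiagonal_eq_sum_range_succ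
      (fun i j => dividedPower D i a * dividedPower D j b) n, dividedPower_apply,
    derivation_pow_mul, Finset.smul_sum]
  refine Finset.sum_congr rfl fun p hp => ?_
  have h := Nat.add_choose_mul_factorial_mul_factorial p.1 p.2
  rw [Nat.choose_symm_add.symm, Finset.HasAntidiagonal.mem_antidiagonal.1 hp] at h
  rw [dividedPower_apply, dividedPower_apply, smul_mul_smul_comm, ← Nat.cast_smul_eq_nsmul ℂ,
    smul_smul, ← h]
  congr 1
  have h1 : (p.1.factorial : ℂ) ≠ 0 := by exact_mod_cast p.1.factorial_ne_zero
  have h2 : (p.2.factorial : ℂ) ≠ 0 := by exact_mod_cast p.2.factorial_ne_zero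
  have h3 : (n.choose p.1 : ℂ) ≠ 0 := by
    exact_mod_cast (Nat.choose_pos (Nat.le.intro (Finset.HasAntidiagonal.mem_antidiagonal.1 hp))).ne'
  push_cast
  field_simp

/-- This binomial coefficient is the one that will match the commutator formula in `pseudoDer_mode`.
-/
theorem dividedPower_dividedPower (i j : ℕ) (a : R) :
    dividedPower D j (dividedPower D i a) = (i + j).choose i • dividedPower D (i + j) a := by
  have h := Nat.add_choose_mul_factorial_mul_factorial i j
  rw [Nat.choose_symm_add.symm] at h
  rw [dividedPower_apply, dividedPower_apply, dividedPower_apply, map_smul,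
    ← Module.End.mul_apply, ← pow_add, add_comm j i, smul_smul, ← Nat.cast_smul_eq_nsmul ℂ,
    smul_smul, ← h]
  congr 1
  have h1 : (i.factorial : ℂ) ≠ 0 := by exact_mod_cast i.factorial_ne_zero
  have h2 : (j.factorial : ℂ) ≠ 0 := by exact_mod_cast j.factorial_ne_zero
  have h3 : ((i + j).choose i : ℂ) ≠ 0 := by
    exact_mod_cast (Nat.choose_pos (Nat.le_add_right i j)).ne'
  push_cast
  field_simp

end DividedPower

theorem finsum_nat_eq_sum_range {M : Type*} [AddCommMonoid M] {g : ℕ → M} {K : ℕ}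
    (h : ∀ j ≥ K, g j = 0) : ∑ᶠ j, g j = ∑ j ∈ Finset.range K, g j := by
  refine finsum_eq_sum_of_support_subset g fun j hj => ?_
  by_contra hlt
  exact hj (h j (by simpa using hlt))

/-! ### Scalar extension to a differential algebra -/

section Scalar

variable {V : Type*} [AddCommGroup V] [Module ℂ V]
variable {R : Type*} [CommRing R] [Algebra ℂ R]

/-- Multiplication by `a : R` on `V ⊗ R`. -/
def scalarMul (V : Type*) [AddCommGroup V] [Module ℂ V] (a : R) : Module.End ℂ (V ⊗[ℂ] R) :=
  (LinearMap.mulLeft ℂ a).lTensor V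

@[simp]
theorem scalarMul_tmul (a b : R) (u : V) : scalarMul V a (u ⊗ₜ b) = u ⊗ₜ[ℂ] (a * b) := by
  simp [scalarMul]

theorem scalarMul_scalarMul (a b : R) (p : V ⊗[ℂ] R) :
    scalarMul V a (scalarMul V b p) = scalarMul V (a * b) p := by
  induction p with
  | zero => simp
  | add p q hp hq => simp [hp, hq]
  | tmul u c => simp [mul_assoc]

theorem scalarMul_one (p : V ⊗[ℂ] R) : scalarMul V 1 p = p := by
  simp [scalarMul]

theorem tmul_eq_scalarMul (u : V) (a : R) : u ⊗ₜ[ℂ] a = scalarMul V a (u ⊗ₜ 1) := by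
  simp

theorem scalarExtension_tmul (Φ : V →ₗ[ℂ] V ⊗[ℂ] R) (u : V) (a : R) :
    scalarExtension Φ (u ⊗ₜ a) = scalarMul V a (Φ u) := by
  simp only [scalarExtension, LinearMap.comp_apply, LinearMap.rTensor_tmul]
  induction Φ u with
  | zero => simp
  | add p q hp hq => simp only [TensorProduct.add_tmul, map_add, hp, hq]
  | tmul w b => simp [mul_comm]

theorem scalarExtension_tmul_one (Φ : V →ₗ[ℂ] V ⊗[ℂ] R) (u : V) :
    scalarExtension Φ (u ⊗ₜ 1) = Φ u := by
  rw [scalarExtension_tmul, scalarMul_one]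

theorem scalarExtension_scalarMul (Φ : V →ₗ[ℂ] V ⊗[ℂ] R) (a : R) (p : V ⊗[ℂ] R) :
    scalarExtension Φ (scalarMul V a p) = scalarMul V a (scalarExtension Φ p) := by
  induction p with
  | zero => simp
  | add p q hp hq => simp only [map_add, hp, hq]
  | tmul u b => rw [scalarMul_tmul, scalarExtension_tmul, scalarExtension_tmul, scalarMul_scalarMul]

theorem scalarExtension_pow_scalarMul (Φ : V →ₗ[ℂ] V ⊗[ℂ] R) (n : ℕ) (a : R) (p : V ⊗[ℂ] R) :
    (scalarExtension Φ ^ n) (scalarMul V a p) = scalarMul V a ((scalarExtension Φ ^ n) p) := by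
  induction n generalizing p with
  | zero => simp
  | succ n ih =>
    rw [pow_succ, Module.End.mul_apply, scalarExtension_scalarMul, ih, Module.End.mul_apply]

theorem scalarExtension_neg (Φ : V →ₗ[ℂ] V ⊗[ℂ] R) :
    scalarExtension (-Φ) = -scalarExtension Φ := by
  ext u a
  simp [scalarExtension_tmul]

/-! ### Products of `V ⊗ R` under `R`-linear extensions -/

namespace VertexData

variable (A : VertexData V) (D : Derivation ℂ R R)

theorem expMode_tmul_eq_sum (n : ℤ) (u w : V) (a b : R) {K : ℕ}
    (hK : ∀ m : ℤ, n + K ≤ m → A.mode u m w = 0) :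
    A.expMode D n (u ⊗ₜ a) (w ⊗ₜ b) =
      ∑ j ∈ Finset.range K, A.mode u (n + j) w ⊗ₜ[ℂ] (dividedPower D j a * b) := by
  rw [expMode_tmul]
  refine finsum_nat_eq_sum_range fun j hj => ?_
  rw [hK _ (by lia), TensorProduct.zero_tmul]

/-- Multiplicativity of exp(x∂) pulls (exp(x∂)a) b out of the product. Allowing every large K lets
several expansions share one bound. -/
theorem expMode_scalarMul (n : ℤ) (a b : R) (p q : V ⊗[ℂ] R) :
    ∃ K₀ : ℕ, ∀ K ≥ K₀, A.expMode D n (scalarMul V a p) (scalarMul V b q) =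
      ∑ j ∈ Finset.range K,
        scalarMul V (dividedPower D j a * b) (A.expMode D (n + j) p q) := by
  induction p with
  | zero => exact ⟨0, by simp⟩
  | add p p' hp hp' =>
    obtain ⟨N, hN⟩ := hp
    obtain ⟨N', hN'⟩ := hp'
    refine ⟨max N N', fun K hK => ?_⟩
    simp only [map_add, LinearMap.add_apply, hN K (le_trans (le_max_left _ _) hK),
      hN' K (le_trans (le_max_right _ _) hK), Finset.sum_add_distrib]
  | tmul u a' =>
    induction q with
    | zero => exact ⟨0, by simp⟩
    | add q q' hq hq' =>
      obtain ⟨N, hN⟩ := hq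
      obtain ⟨N', hN'⟩ := hq'
      refine ⟨max N N', fun K hK => ?_⟩
      simp only [map_add, hN K (le_trans (le_max_left _ _) hK),
        hN' K (le_trans (le_max_right _ _) hK), Finset.sum_add_distrib]
    | tmul w b' =>
      obtain ⟨N, hN⟩ := A.exists_mode_eq_zero u w
      refine ⟨(N - n).toNat, fun K hK => ?_⟩
      rw [scalarMul_tmul, scalarMul_tmul,
        A.expMode_tmul_eq_sum D n u w _ _ (K := K) fun m hm => hN m (by lia)]
      -- One sum over the triangle i + l < K: grouped by i + l it is the left side, grouped by i the
      -- right side.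
      have key := Finset.sum_range_diag_flip K fun i l : ℕ =>
        A.mode u (n + i + l) w ⊗ₜ[ℂ]
          (dividedPower D i a * b * (dividedPower D l a' * b'))
      refine Eq.trans ?_ (key.trans ?_)
      · refine Finset.sum_congr rfl fun j _ => ?_
        rw [dividedPower_mul, Finset.sum_mul, TensorProduct.tmul_sum]
        refine Finset.sum_congr rfl fun i hi => ?_
        have hi' : i ≤ j := Nat.lt_succ_iff.1 (Finset.mem_range.1 hi)
        rw [show n + (i : ℤ) + ((j - i : ℕ) : ℤ) = n + j by lia]
        congr 1
        ring
      · refine Finset.sum_congr rfl fun i hi => ?_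
        rw [Finset.mem_range] at hi
        rw [A.expMode_tmul_eq_sum D (n + i) u w a' b' (K := K - i) fun m hm => hN m (by lia),
          map_sum]
        simp

/-- An `R`-linear extension respects all products as soon as it respects those of `V`. -/
theorem scalarExtension_expMode {Φ : V →ₗ[ℂ] V ⊗[ℂ] R}
    (h : ∀ (u w : V) (n : ℤ), Φ (A.mode u n w) = A.expMode D n (Φ u) (Φ w))
    (n : ℤ) (p q : V ⊗[ℂ] R) :
    scalarExtension Φ (A.expMode D n p q) =
      A.expMode D n (scalarExtension Φ p) (scalarExtension Φ q) := by
  induction p with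
  | zero => simp
  | add p p' hp hp' => simp only [map_add, LinearMap.add_apply, hp, hp']
  | tmul u a =>
    induction q with
    | zero => simp
    | add q q' hq hq' => simp only [map_add, hq, hq']
    | tmul w b =>
      obtain ⟨N, hN⟩ := A.exists_mode_eq_zero u w
      obtain ⟨K, hK⟩ := A.expMode_scalarMul D n a b (Φ u) (Φ w)
      rw [scalarExtension_tmul, scalarExtension_tmul, hK _ (le_max_left K (N - n).toNat),
        A.expMode_tmul_eq_sum D n u w a b (K := max K (N - n).toNat) fun m hm => hN m (by lia),
        map_sum]
      refine Finset.sum_congr rfl fun j _ => ?_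
      rw [scalarExtension_tmul, h]

/-- An `R`-linear extension is a derivation as soon as it is one on `V`. -/
theorem scalarExtension_derivation {Φ : V →ₗ[ℂ] V ⊗[ℂ] R}
    (h : ∀ (u w : V) (n : ℤ), Φ (A.mode u n w) =
      A.expMode D n (Φ u) (w ⊗ₜ 1) + A.expMode D n (u ⊗ₜ 1) (Φ w))
    (n : ℤ) (p q : V ⊗[ℂ] R) :
    scalarExtension Φ (A.expMode D n p q) =
      A.expMode D n (scalarExtension Φ p) q + A.expMode D n p (scalarExtension Φ q) := by
  induction p with
  | zero => simp
  | add p p' hp hp' =>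
    simp only [map_add, LinearMap.add_apply, hp, hp']
    abel
  | tmul u a =>
    induction q with
    | zero => simp
    | add q q' hq hq' =>
      simp only [map_add, hq, hq']
      abel
    | tmul w b =>
      obtain ⟨N, hN⟩ := A.exists_mode_eq_zero u w
      obtain ⟨K₁, hK₁⟩ := A.expMode_scalarMul D n a b (Φ u) (w ⊗ₜ 1)
      obtain ⟨K₂, hK₂⟩ := A.expMode_scalarMul D n a b (u ⊗ₜ 1) (Φ w)
      have hK := A.expMode_tmul_eq_sum D n u w a b (K := max (max K₁ K₂) (N - n).toNat)
        fun m hm => hN m (by lia)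
      rw [hK, map_sum, scalarExtension_tmul, scalarExtension_tmul]
      -- All three terms become Taylor expansions with the same scalar coefficients, so `h` applies
      -- termwise.
      rw [tmul_eq_scalarMul u a, tmul_eq_scalarMul w b,
        hK₁ (max (max K₁ K₂) (N - n).toNat) (by lia), hK₂ (max (max K₁ K₂) (N - n).toNat) (by lia),
        ← Finset.sum_add_distrib]
      refine Finset.sum_congr rfl fun j _ => ?_
      rw [scalarExtension_tmul, h, map_add]

/-- The Leibniz rule for iterates of a derivation. -/
theorem scalarExtension_pow_expMode {Φ : V →ₗ[ℂ] V ⊗[ℂ] R}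
    (h : ∀ (u w : V) (n : ℤ), Φ (A.mode u n w) =
      A.expMode D n (Φ u) (w ⊗ₜ 1) + A.expMode D n (u ⊗ₜ 1) (Φ w))
    (n : ℤ) (p q : V ⊗[ℂ] R) (N : ℕ) :
    (N.factorial : ℂ)⁻¹ • (scalarExtension Φ ^ N) (A.expMode D n p q) =
      ∑ i ∈ Finset.range (N + 1),
        A.expMode D n ((i.factorial : ℂ)⁻¹ • (scalarExtension Φ ^ i) p)
          (((N - i).factorial : ℂ)⁻¹ • (scalarExtension Φ ^ (N - i)) q) := by
  have key : (scalarExtension Φ ^ N) (A.expMode D n p q) =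
      ∑ x ∈ Finset.HasAntidiagonal.antidiagonal N,
      N.choose x.1 • A.expMode D n ((scalarExtension Φ ^ x.1) p)
        ((scalarExtension Φ ^ x.2) q) := by
    induction N with
    | zero => simp
    | succ N ih =>
      rw [Finset.sum_antidiagonal_choose_succ_nsmul
        (fun i j => A.expMode D n ((scalarExtension Φ ^ i) p) ((scalarExtension Φ ^ j) q)) N,
        pow_succ', Module.End.mul_apply, ih, map_sum, ← Finset.sum_add_distrib]
      refine Finset.sum_congr rfl fun x hx => ?_
      rw [map_nsmul, ← Nat.choose_symm_of_eq_add (Finset.HasAntidiagonal.mem_antidiagonal.1 hx).symm,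
        pow_succ', pow_succ', Module.End.mul_apply, Module.End.mul_apply, ← nsmul_add,
        A.scalarExtension_derivation D h, add_comm]
  rw [key, ← Nat.succ_eq_add_one, ← Finset.Nat.sum_antidiagonal_eq_sum_range_succ
      (fun i j => A.expMode D n ((i.factorial : ℂ)⁻¹ • (scalarExtension Φ ^ i) p)
        ((j.factorial : ℂ)⁻¹ • (scalarExtension Φ ^ j) q)) N, Finset.smul_sum]
  refine Finset.sum_congr rfl fun x hx => ?_
  have hf := Nat.add_choose_mul_factorial_mul_factorial x.1 x.2
  rw [Nat.choose_symm_add.symm, Finset.HasAntidiagonal.mem_antidiagonal.1 hx] at hf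
  rw [map_smul, map_smul, LinearMap.smul_apply, smul_smul, ← Nat.cast_smul_eq_nsmul ℂ, smul_smul,
    ← hf]
  congr 1
  have h1 : (x.1.factorial : ℂ) ≠ 0 := by exact_mod_cast x.1.factorial_ne_zero
  have h2 : (x.2.factorial : ℂ) ≠ 0 := by exact_mod_cast x.2.factorial_ne_zero
  have h3 : (N.choose x.1 : ℂ) ≠ 0 := by
    exact_mod_cast (Nat.choose_pos (Nat.le.intro (Finset.HasAntidiagonal.mem_antidiagonal.1 hx))).ne'
  push_cast
  field_simp

theorem pseudoDer_eq_sum (v : V) (f : R) (w : V) {K : ℕ}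
    (hK : ∀ m : ℤ, (K : ℤ) ≤ m → A.mode v m w = 0) :
    A.pseudoDer D v f w =
      ∑ j ∈ Finset.range K, A.mode v j w ⊗ₜ[ℂ] dividedPower D j f := by
  refine finsum_nat_eq_sum_range fun j hj => ?_
  rw [hK _ (by lia), TensorProduct.zero_tmul]

end VertexData

/-! ### The commutator formula -/

namespace VertexAlgebra

variable (A : VertexAlgebra V)

/-- The Jacobi identity at l = 0: `Ring.choose 0 i` leaves only i = 0 on the right, and m ≥ 0 stops
the left sum at i = m. -/
theorem mode_mode_sub (u v w : V) (m : ℕ) (n : ℤ) :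
    A.mode u m (A.mode v n w) - A.mode v n (A.mode u m w) =
      ∑ i ∈ Finset.range (m + 1), m.choose i • A.mode (A.mode u i v) (m + n - i) w := by
  have h := A.jacobi u v w 0 m n
  rw [finsum_nat_eq_sum_range (K := m + 1), finsum_nat_eq_sum_range (K := 1)] at h
  · simp only [Finset.range_one, Finset.sum_singleton, pow_zero, Ring.choose_zero_right,
      one_smul, zero_add, zpow_zero, Nat.cast_zero, add_zero, sub_zero,
      mul_one] at h
    rw [← h]
    refine Finset.sum_congr rfl fun i _ => ?_
    rw [Ring.choose_natCast, Nat.cast_smul_eq_nsmul]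
  · intro j hj
    rw [Ring.choose_zero_pos ℤ (by lia)]
    simp
  · intro j hj
    rw [Ring.choose_natCast, Nat.choose_eq_zero_of_lt (by lia)]
    simp

theorem pseudoDer_vac (D : Derivation ℂ R R) (v : V) (f : R) :
    A.pseudoDer D v f A.vac = 0 := by
  rw [A.pseudoDer_eq_sum D v f A.vac (K := 0)
    fun m hm => A.mode_vac_of_nonneg v m (by simpa using hm)]
  simp

/-- Multiply the commutator of v_m and u_n by ∂^m f / m! and put m = i + j: the binomial turns ∂^m f
/ m! into ∂^j/j! applied to ∂^i f / i!, as exp(x∂) requires. The factor u ⊗ 1 acts as u_n because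
exp(x∂) fixes 1. -/
theorem pseudoDer_mode (D : Derivation ℂ R R) (v : V) (f : R) (u w : V) (n : ℤ) :
    A.pseudoDer D v f (A.mode u n w) =
      A.expMode D n (A.pseudoDer D v f u) (w ⊗ₜ 1) +
        A.expMode D n (u ⊗ₜ 1) (A.pseudoDer D v f w) := by
  obtain ⟨N₁, h₁⟩ := A.exists_mode_eq_zero v (A.mode u n w)
  obtain ⟨N₂, h₂⟩ := A.exists_mode_eq_zero v w
  obtain ⟨N₃, h₃⟩ := A.exists_mode_eq_zero v u
  -- Only finitely many v_i u can be nonzero, so one bound serves them all.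
  have h₄ : ∃ N : ℤ, ∀ i : ℕ, (i : ℤ) < N₃ → ∀ m ≥ N, A.mode (A.mode v i u) m w = 0 := by
    choose M hM using fun i : ℕ => A.exists_mode_eq_zero (A.mode v i u) w
    obtain ⟨B, hB⟩ := ((Finset.range N₃.toNat).image M).exists_le
    refine ⟨B, fun i hi m hm => hM i m (le_trans (hB _ ?_) hm)⟩
    exact Finset.mem_image_of_mem _ (Finset.mem_range.2 (by lia))
  obtain ⟨N₄, h₄⟩ := h₄
  -- A sum, not a maximum: the inner ranges have length K - i and must still reach N₄ - n whenever i
  -- < N₃.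
  set K : ℕ := N₁.toNat + N₂.toNat + N₃.toNat + (N₄ - n).toNat + N₃.toNat with hK
  have e2 : A.expMode D n (u ⊗ₜ 1) (A.pseudoDer D v f w) =
      ∑ m ∈ Finset.range K, A.mode u n (A.mode v m w) ⊗ₜ[ℂ] dividedPower D m f := by
    rw [A.pseudoDer_eq_sum D v f w (K := K) fun m hm => h₂ m (by lia), map_sum]
    refine Finset.sum_congr rfl fun m _ => ?_
    rw [A.expMode_tmul]
    rw [finsum_nat_eq_sum_range (K := 1)]
    · simp [dividedPower_zero]
    · intro j hj
      rw [dividedPower_one, if_neg (by lia)]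
      simp
  have e1 : A.expMode D n (A.pseudoDer D v f u) (w ⊗ₜ 1) =
      ∑ i ∈ Finset.range K, ∑ j ∈ Finset.range (K - i), (i + j).choose i •
        (A.mode (A.mode v i u) (n + j) w ⊗ₜ[ℂ] dividedPower D (i + j) f) := by
    rw [A.pseudoDer_eq_sum D v f u (K := K) fun m hm => h₃ m (by lia), map_sum,
      LinearMap.sum_apply]
    refine Finset.sum_congr rfl fun i hi => ?_
    rw [Finset.mem_range] at hi
    rw [A.expMode_tmul_eq_sum D n _ w _ _ (K := K - i)]
    · refine Finset.sum_congr rfl fun j _ => ?_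
      rw [dividedPower_dividedPower, mul_one, TensorProduct.tmul_smul]
    · intro m hm
      by_cases hi3 : (i : ℤ) < N₃
      · exact h₄ i hi3 m (by lia)
      · rw [h₃ i (by lia)]
        simp [VertexData.mode]
  rw [e2, e1, A.pseudoDer_eq_sum D v f _ (K := K) fun m hm => h₁ m (by lia),
    ← Finset.sum_range_diag_flip K fun i j : ℕ => (i + j).choose i •
        (A.mode (A.mode v i u) (n + j) w ⊗ₜ[ℂ] dividedPower D (i + j) f),
    ← Finset.sum_add_distrib]
  refine Finset.sum_congr rfl fun m _ => ?_
  rw [← sub_eq_iff_eq_add, ← TensorProduct.sub_tmul, A.mode_mode_sub, TensorProduct.sum_tmul]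
  refine Finset.sum_congr rfl fun i hi => ?_
  have hi' : i ≤ m := Nat.lt_succ_iff.1 (Finset.mem_range.1 hi)
  rw [show n + ((m - i : ℕ) : ℤ) = m + n - i by lia, Nat.add_sub_cancel' hi',
    TensorProduct.smul_tmul']

end VertexAlgebra

end Scalar

/-! ### The `z`-adic filtration -/

theorem zPowSubspace_anti {m n : ℤ} (h : m ≤ n) : zPowSubspace n ≤ zPowSubspace m :=
  fun _ hg i hi => hg i (lt_of_lt_of_le hi h)

theorem one_mem_zPowSubspace : (1 : ℂ⸨X⸩) ∈ zPowSubspace 0 := by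
  intro n hn
  rw [HahnSeries.coeff_one, if_neg hn.ne]

theorem mul_mem_zPowSubspace {m n : ℤ} {a b : ℂ⸨X⸩} (ha : a ∈ zPowSubspace m)
    (hb : b ∈ zPowSubspace n) : a * b ∈ zPowSubspace (m + n) := by
  intro i hi
  rw [HahnSeries.coeff_mul]
  refine Finset.sum_eq_zero fun p hp => ?_
  have hp' : p.1 + p.2 = i := (Finset.mem_antidiagonal.1 hp).2.2
  by_cases h : p.1 < m
  · rw [ha _ h, zero_mul]
  · rw [hb _ (by lia), mul_zero]

theorem laurentDerivation_mem_zPowSubspace {m : ℤ} {a : ℂ⸨X⸩} (ha : a ∈ zPowSubspace m) :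
    laurentDerivation a ∈ zPowSubspace (m - 1) := by
  intro i hi
  change (LaurentSeries.derivative ℂ a).coeff i = 0
  rw [LaurentSeries.derivative_apply, LaurentSeries.hasseDeriv_coeff, ha _ (by push_cast; lia),
    smul_zero]

theorem dividedPower_mem_zPowSubspace {m : ℤ} {a : ℂ⸨X⸩} (ha : a ∈ zPowSubspace m) (j : ℕ) :
    dividedPower laurentDerivation j a ∈ zPowSubspace (m - j) := by
  rw [dividedPower_apply]
  refine Submodule.smul_mem _ _ ?_
  induction j with
  | zero => simpa using ha
  | succ j ih =>
    rw [pow_succ', Module.End.mul_apply]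
    have := laurentDerivation_mem_zPowSubspace ih
    rwa [show m - ((j + 1 : ℕ) : ℤ) = m - j - 1 by push_cast; ring]

theorem eq_zero_of_forall_mem_zPowSubspace {a : ℂ⸨X⸩} (C : ℤ)
    (h : ∀ N : ℕ, a ∈ zPowSubspace (N - C)) : a = 0 := by
  ext i
  exact h (i + C + 1).toNat i (by lia)

/-- Only the terms with n ≤ j + C reach the coefficient of z^j, so each coefficient of the limit is
a finite sum. -/
theorem exists_laurent_sum (g : ℕ → ℂ⸨X⸩) (C : ℤ) (hg : ∀ n : ℕ, g n ∈ zPowSubspace (n - C)) :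
    ∃ a : ℂ⸨X⸩, ∀ N : ℕ, a - ∑ n ∈ Finset.range N, g n ∈ zPowSubspace (N - C) := by
  let c : ℤ → ℂ := fun j => ∑ n ∈ Finset.range (j + C + 1).toNat, (g n).coeff j
  have hc : BddBelow (Function.support c) := by
    refine ⟨-C, fun j hj => ?_⟩
    by_contra hlt
    refine hj (Finset.sum_eq_zero fun n _ => hg n j (by lia))
  refine ⟨HahnSeries.ofSuppBddBelow c hc, fun N j hj => ?_⟩
  have h : (∑ n ∈ Finset.range N, g n).coeff j = ∑ n ∈ Finset.range N, (g n).coeff j := by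
    simp
  rw [HahnSeries.coeff_sub, h]
  change c j - _ = 0
  rw [sub_eq_zero]
  refine Finset.sum_subset (Finset.range_mono (by lia)) fun n _ hn => hg n j ?_
  rw [Finset.mem_range] at hn
  lia

section Filtration

variable {V : Type*} [AddCommGroup V] [Module ℂ V]

/-- The image of `U ⊗ z ^ m ℂ[[z]]` in `V ⊗ ℂ((z))`. -/
abbrev tensorZPow (U : Submodule ℂ V) (m : ℤ) : Submodule ℂ (V ⊗[ℂ] ℂ⸨X⸩) :=
  Submodule.map₂ (TensorProduct.mk ℂ V ℂ⸨X⸩) U (zPowSubspace m)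

theorem tmul_mem_tensorZPow {U : Submodule ℂ V} {m : ℤ} {u : V} {a : ℂ⸨X⸩} (hu : u ∈ U)
    (ha : a ∈ zPowSubspace m) : u ⊗ₜ a ∈ tensorZPow U m :=
  Submodule.apply_mem_map₂ (TensorProduct.mk ℂ V ℂ⸨X⸩) hu ha

theorem tensorZPow_mono {U U' : Submodule ℂ V} {m n : ℤ} (hU : U ≤ U') (h : m ≤ n) :
    tensorZPow U n ≤ tensorZPow U' m :=
  Submodule.map₂_le_map₂ hU (zPowSubspace_anti h)

/-- A linear map with the right values on pure tensors respects the filtrations. -/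
theorem map_mem_of_mem_tensorZPow {W : Type*} [AddCommGroup W] [Module ℂ W]
    {U : Submodule ℂ V} {m : ℤ} {S : Submodule ℂ W} (T : V ⊗[ℂ] ℂ⸨X⸩ →ₗ[ℂ] W)
    (h : ∀ u ∈ U, ∀ a ∈ zPowSubspace m, T (u ⊗ₜ a) ∈ S) {p : V ⊗[ℂ] ℂ⸨X⸩}
    (hp : p ∈ tensorZPow U m) : T p ∈ S := by
  have : tensorZPow U m ≤ S.comap T := Submodule.map₂_le.2 h
  exact this hp

theorem scalarMul_mem_tensorZPow {U : Submodule ℂ V} {m n : ℤ} {a : ℂ⸨X⸩}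
    (ha : a ∈ zPowSubspace m) {p : V ⊗[ℂ] ℂ⸨X⸩} (hp : p ∈ tensorZPow U n) :
    scalarMul V a p ∈ tensorZPow U (m + n) := by
  refine map_mem_of_mem_tensorZPow _ (fun u hu b hb => ?_) hp
  rw [scalarMul_tmul]
  exact tmul_mem_tensorZPow hu (mul_mem_zPowSubspace ha hb)

/-- Coordinates along a basis of V, possibly infinite, reduce separatedness to Laurent series. -/
theorem eq_zero_of_forall_mem_tensorZPow {p : V ⊗[ℂ] ℂ⸨X⸩} (C : ℤ)
    (h : ∀ N : ℕ, p ∈ tensorZPow ⊤ (N - C)) : p = 0 := by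
  classical
  refine (TensorProduct.equivFinsuppOfBasisLeft (N := ℂ⸨X⸩)
    (Module.Basis.ofVectorSpace ℂ V)).map_eq_zero_iff.1 ?_
  ext1 i
  rw [TensorProduct.equivFinsuppOfBasisLeft_apply, Finsupp.zero_apply]
  refine eq_zero_of_forall_mem_zPowSubspace C fun N => ?_
  refine map_mem_of_mem_tensorZPow ((TensorProduct.lid ℂ ℂ⸨X⸩).toLinearMap ∘ₗ
    LinearMap.rTensor ℂ⸨X⸩ ((Module.Basis.ofVectorSpace ℂ V).coord i)) (fun u _ a ha => ?_) (h N)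
  simpa using Submodule.smul_mem _ _ ha

theorem exists_coordinates_of_mem_tensorZPow {ι : Type*} [Fintype ι] {U : Submodule ℂ V}
    (b : Module.Basis ι ℂ U) {m : ℤ} {p : V ⊗[ℂ] ℂ⸨X⸩} (hp : p ∈ tensorZPow U m) :
    ∃ g : ι → ℂ⸨X⸩, (∀ i, g i ∈ zPowSubspace m) ∧ p = ∑ i, (b i : V) ⊗ₜ g i := by
  let T : (ι → ℂ⸨X⸩) →ₗ[ℂ] V ⊗[ℂ] ℂ⸨X⸩ :=
    ∑ i, (TensorProduct.mk ℂ V ℂ⸨X⸩ (b i : V)) ∘ₗ LinearMap.proj i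
  have hle : tensorZPow U m ≤ (Submodule.pi Set.univ fun _ : ι => zPowSubspace m).map T := by
    refine Submodule.map₂_le.2 fun u hu a ha => ?_
    refine ⟨fun i => b.repr ⟨u, hu⟩ i • a, fun i _ => Submodule.smul_mem _ _ ha, ?_⟩
    have hu' : u = ∑ i, b.repr ⟨u, hu⟩ i • (b i : V) := by
      have := congrArg (Subtype.val) (b.sum_repr ⟨u, hu⟩)
      rw [Submodule.coe_sum] at this
      exact this.symm
    conv_rhs => rw [hu']
    simp [T, TensorProduct.smul_tmul']
  obtain ⟨g, hg, rfl⟩ := hle hp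
  exact ⟨g, fun i => hg i (Set.mem_univ i), by simp [T]⟩

/-- Completeness of `U ⊗ ℂ((z))` for a finite-dimensional `U`. -/
theorem exists_tensor_sum {U : Submodule ℂ V} (hU : U.FG) (s : ℕ → V ⊗[ℂ] ℂ⸨X⸩) (C : ℤ)
    (hs : ∀ n : ℕ, s n ∈ tensorZPow U (n - C)) :
    ∃ e : V ⊗[ℂ] ℂ⸨X⸩, ∀ N : ℕ, e - ∑ n ∈ Finset.range N, s n ∈ tensorZPow U (N - C) := by
  have : Module.Finite ℂ U := Module.Finite.iff_fg.2 hU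
  let b := Module.finBasis ℂ U
  choose g hg hsg using fun n => exists_coordinates_of_mem_tensorZPow b (hs n)
  choose a ha using fun i => exists_laurent_sum (fun n => g n i) C fun n => hg n i
  refine ⟨∑ i, (b i : V) ⊗ₜ a i, fun N => ?_⟩
  have : ∑ i, (b i : V) ⊗ₜ[ℂ] a i - ∑ n ∈ Finset.range N, s n =
      ∑ i, (b i : V) ⊗ₜ[ℂ] (a i - ∑ n ∈ Finset.range N, g n i) := by
    simp only [hsg, TensorProduct.tmul_sub, TensorProduct.tmul_sum, Finset.sum_sub_distrib]
    rw [Finset.sum_comm]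
  rw [this]
  exact Submodule.sum_mem _ fun i _ => tmul_mem_tensorZPow (b i).2 (ha i N)

/-- This merges the order estimate, known only over V, with membership in U ⊗ ℂ((z)): a projection
of V onto U fixes p and acts on no power of z. -/
theorem mem_tensorZPow_of_mem_map₂_top {U : Submodule ℂ V} {m : ℤ} {p : V ⊗[ℂ] ℂ⸨X⸩}
    (hp : p ∈ tensorZPow ⊤ m) (hU : p ∈ Submodule.map₂ (TensorProduct.mk ℂ V ℂ⸨X⸩) U ⊤) :
    p ∈ tensorZPow U m := by
  obtain ⟨π, hπ⟩ := (LinearMap.id : U →ₗ[ℂ] U).exists_extend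
  have h1 : (U.subtype ∘ₗ π).rTensor ℂ⸨X⸩ p = p := by
    have hle : Submodule.map₂ (TensorProduct.mk ℂ V ℂ⸨X⸩) U ⊤ ≤
        LinearMap.eqLocus ((U.subtype ∘ₗ π).rTensor ℂ⸨X⸩) LinearMap.id := by
      refine Submodule.map₂_le.2 fun u hu a _ => ?_
      have := LinearMap.congr_fun hπ ⟨u, hu⟩
      simp only [LinearMap.comp_apply, Submodule.subtype_apply, LinearMap.id_apply] at this
      simp [LinearMap.mem_eqLocus, this]
    exact hle hU
  rw [← h1]
  refine map_mem_of_mem_tensorZPow _ (fun u _ a ha => ?_) hp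
  exact tmul_mem_tensorZPow (π u).2 ha

theorem VertexData.exists_forall_mode_eq_zero (A : VertexData V) {U W : Submodule ℂ V}
    (hU : U.FG) (hW : W.FG) : ∃ N : ℤ, ∀ u ∈ U, ∀ w ∈ W, ∀ n ≥ N, A.mode u n w = 0 := by
  obtain ⟨s, rfl⟩ := hU
  obtain ⟨t, rfl⟩ := hW
  choose M hM using A.exists_mode_eq_zero
  obtain ⟨N, hN⟩ := ((s ×ˢ t).image fun x : V × V => M x.1 x.2).exists_le
  refine ⟨N, fun u hu w hw n hn => ?_⟩
  induction hu using Submodule.span_induction with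
  | zero => simp [VertexData.mode]
  | add x y _ _ hx hy => simp [A.mode_add, hx, hy]
  | smul c x _ hx => simp [A.mode_smul, hx]
  | mem u hu =>
    induction hw using Submodule.span_induction with
    | zero => simp
    | add x y _ _ hx hy => simp [hx, hy]
    | smul c x _ hx => simp [hx]
    | mem w hw =>
      refine hM u w n (le_trans (hN _ ?_) hn)
      exact Finset.mem_image.2 ⟨(u, w), Finset.mem_product.2 ⟨hu, hw⟩, rfl⟩

/-- Continuity of the products of `V ⊗ ℂ((z))`. -/
theorem VertexData.exists_expMode_mem_tensorZPow (A : VertexData V) (n : ℤ)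
    {U W : Submodule ℂ V} (hU : U.FG) (hW : W.FG) :
    ∃ C : ℤ, ∀ (l m : ℤ), ∀ p ∈ tensorZPow U l, ∀ q ∈ tensorZPow W m,
      A.expMode laurentDerivation n p q ∈ tensorZPow ⊤ (l + m - C) := by
  obtain ⟨N, hN⟩ := A.exists_forall_mode_eq_zero hU hW
  -- Each derivative costs one power of z, and fewer than (N - n).toNat of them occur.
  refine ⟨(N - n).toNat, fun l m p hp q hq => ?_⟩
  refine map_mem_of_mem_tensorZPow (S := tensorZPow ⊤ _) ((A.expMode laurentDerivation n).flip q)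
    (fun u hu a ha => ?_) hp
  rw [LinearMap.flip_apply]
  refine map_mem_of_mem_tensorZPow (A.expMode laurentDerivation n (u ⊗ₜ a))
    (fun w hw b hb => ?_) hq
  rw [A.expMode_tmul_eq_sum laurentDerivation n u w a b (K := (N - n).toNat)
    fun i hi => hN u hu w hw i (by lia)]
  refine Submodule.sum_mem _ fun j hj => tmul_mem_tensorZPow Submodule.mem_top ?_
  rw [Finset.mem_range] at hj
  exact zPowSubspace_anti (by lia)
    (mul_mem_zPowSubspace (dividedPower_mem_zPowSubspace ha j) hb)

end Filtration

/-! ### Formal exponentials -/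

section FormalExp

variable {V : Type*} [AddCommGroup V] [Module ℂ V]

/-- The partial sum `∑_{n < N} Φ ^ n p / n!`. -/
noncomputable def expSum (Φ : V →ₗ[ℂ] V ⊗[ℂ] ℂ⸨X⸩) (N : ℕ) : Module.End ℂ (V ⊗[ℂ] ℂ⸨X⸩) :=
  ∑ n ∈ Finset.range N, (n.factorial : ℂ)⁻¹ • scalarExtension Φ ^ n

theorem expSum_apply (Φ : V →ₗ[ℂ] V ⊗[ℂ] ℂ⸨X⸩) (N : ℕ) (p : V ⊗[ℂ] ℂ⸨X⸩) :
    expSum Φ N p =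
      ∑ n ∈ Finset.range N, (n.factorial : ℂ)⁻¹ • (scalarExtension Φ ^ n) p := by
  simp [expSum, LinearMap.sum_apply]

theorem expSum_zero (Φ : V →ₗ[ℂ] V ⊗[ℂ] ℂ⸨X⸩) : expSum Φ 0 = 0 := by
  simp [expSum]

theorem expSum_scalarMul (Φ : V →ₗ[ℂ] V ⊗[ℂ] ℂ⸨X⸩) (N : ℕ) (a : ℂ⸨X⸩) (p : V ⊗[ℂ] ℂ⸨X⸩) :
    expSum Φ N (scalarMul V a p) = scalarMul V a (expSum Φ N p) := by
  simp only [expSum_apply, scalarExtension_pow_scalarMul, map_sum, map_smul]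

/-- `e` is the `z`-adic limit, at a linear rate, of the exponential series of `Φ` at `w`. -/
def IsExpValue (Φ : V →ₗ[ℂ] V ⊗[ℂ] ℂ⸨X⸩) (w : V) (e : V ⊗[ℂ] ℂ⸨X⸩) : Prop :=
  ∃ C : ℤ, ∀ N : ℕ, e - expSum Φ N (w ⊗ₜ 1) ∈ tensorZPow ⊤ (N - C)

/-- Measuring the limit in all of V allows limits found in different subspaces U to be compared;
linearity of exp rests on this. -/
theorem IsExpValue.unique {Φ : V →ₗ[ℂ] V ⊗[ℂ] ℂ⸨X⸩} {w : V} {e e' : V ⊗[ℂ] ℂ⸨X⸩}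
    (h : IsExpValue Φ w e) (h' : IsExpValue Φ w e') : e = e' := by
  obtain ⟨C, hC⟩ := h
  obtain ⟨C', hC'⟩ := h'
  refine sub_eq_zero.1 (eq_zero_of_forall_mem_tensorZPow (max C C') fun N => ?_)
  have := Submodule.sub_mem _
    (tensorZPow_mono le_rfl (show (N : ℤ) - max C C' ≤ N - C by lia) (hC N))
    (tensorZPow_mono le_rfl (show (N : ℤ) - max C C' ≤ N - C' by lia) (hC' N))
  simpa using this

theorem IsExpValue.add {Φ : V →ₗ[ℂ] V ⊗[ℂ] ℂ⸨X⸩} {w w' : V} {e e' : V ⊗[ℂ] ℂ⸨X⸩}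
    (h : IsExpValue Φ w e) (h' : IsExpValue Φ w' e') : IsExpValue Φ (w + w') (e + e') := by
  obtain ⟨C, hC⟩ := h
  obtain ⟨C', hC'⟩ := h'
  refine ⟨max C C', fun N => ?_⟩
  have := Submodule.add_mem _
    (tensorZPow_mono le_rfl (show (N : ℤ) - max C C' ≤ N - C by lia) (hC N))
    (tensorZPow_mono le_rfl (show (N : ℤ) - max C C' ≤ N - C' by lia) (hC' N))
  rw [TensorProduct.add_tmul, map_add]
  convert this using 1
  abel

theorem IsExpValue.smul {Φ : V →ₗ[ℂ] V ⊗[ℂ] ℂ⸨X⸩} {w : V} {e : V ⊗[ℂ] ℂ⸨X⸩} (c : ℂ)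
    (h : IsExpValue Φ w e) : IsExpValue Φ (c • w) (c • e) := by
  obtain ⟨C, hC⟩ := h
  refine ⟨C, fun N => ?_⟩
  rw [← TensorProduct.smul_tmul', map_smul, ← smul_sub]
  exact Submodule.smul_mem _ _ (hC N)

/-- The iterates of `Φ` on the finite-dimensional space `U` stay in `U ⊗ ℂ((z))`, and they tend to
zero at a linear rate. -/
structure IsContractedBy (Φ : V →ₗ[ℂ] V ⊗[ℂ] ℂ⸨X⸩) (U : Submodule ℂ V) (C : ℤ) : Prop where
  fg : U.FG
  pow_mem : ∀ u ∈ U, ∀ n : ℕ, (scalarExtension Φ ^ n) (u ⊗ₜ 1) ∈ tensorZPow U (n - C)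

theorem end_neg_pow_apply {M : Type*} [AddCommGroup M] [Module ℂ M] (T : Module.End ℂ M) (n : ℕ)
    (p : M) : ((-T) ^ n) p = (-1 : ℂ) ^ n • (T ^ n) p := by
  rw [← neg_one_smul ℂ T, smul_pow, LinearMap.smul_apply]

theorem IsContractedBy.neg {Φ : V →ₗ[ℂ] V ⊗[ℂ] ℂ⸨X⸩} {U : Submodule ℂ V} {C : ℤ}
    (h : IsContractedBy Φ U C) : IsContractedBy (-Φ) U C where
  fg := h.fg
  pow_mem u hu n := by
    rw [scalarExtension_neg, end_neg_pow_apply]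
    exact Submodule.smul_mem _ _ (h.pow_mem u hu n)

/-- The exponential of a locally contracted map exists. -/
theorem exists_formalExp {Φ : V →ₗ[ℂ] V ⊗[ℂ] ℂ⸨X⸩}
    (h : ∀ w, ∃ U C, w ∈ U ∧ IsContractedBy Φ U C) :
    ∃ E : V →ₗ[ℂ] V ⊗[ℂ] ℂ⸨X⸩, (∀ w, IsExpValue Φ w (E w)) ∧
      ∀ U C, IsContractedBy Φ U C → ∀ w ∈ U, ∀ N : ℕ,
        E w - expSum Φ N (w ⊗ₜ 1) ∈ tensorZPow U (N - C) := by
  have hex : ∀ U C, IsContractedBy Φ U C → ∀ w ∈ U, ∃ e, ∀ N : ℕ,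
      e - expSum Φ N (w ⊗ₜ 1) ∈ tensorZPow U (N - C) := fun U C hU w hw => by
    simp only [expSum_apply]
    exact exists_tensor_sum hU.fg _ C fun n => Submodule.smul_mem _ _ (hU.pow_mem w hw n)
  have hval : ∀ w, ∃ e, IsExpValue Φ w e := fun w => by
    obtain ⟨U, C, hw, hU⟩ := h w
    obtain ⟨e, he⟩ := hex U C hU w hw
    exact ⟨e, C, fun N => tensorZPow_mono le_top le_rfl (he N)⟩
  choose E hE using hval
  refine ⟨{ toFun := E
            map_add' := fun w w' => (hE _).unique ((hE w).add (hE w'))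
            map_smul' := fun c w => (hE _).unique ((hE w).smul c) }, hE, ?_⟩
  intro U C hU w hw N
  obtain ⟨e, he⟩ := hex U C hU w hw
  -- The value chosen earlier may come from another subspace; uniqueness transfers the estimate to
  -- the given U.
  have : E w = e := (hE w).unique ⟨C, fun N => tensorZPow_mono le_top le_rfl (he N)⟩
  rw [LinearMap.coe_mk, AddHom.coe_mk, this]
  exact he N

/-- Scalar linearity spreads the estimate from U ⊗ 1. At N = 0 it bounds the extension of E itself,
which controls its effect on tails. -/
theorem scalarExtension_sub_expSum_mem {Φ E : V →ₗ[ℂ] V ⊗[ℂ] ℂ⸨X⸩} {U : Submodule ℂ V} {C : ℤ}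
    (hE : ∀ w ∈ U, ∀ N : ℕ, E w - expSum Φ N (w ⊗ₜ 1) ∈ tensorZPow U (N - C))
    {m : ℤ} {p : V ⊗[ℂ] ℂ⸨X⸩} (hp : p ∈ tensorZPow U m) (N : ℕ) :
    scalarExtension E p - expSum Φ N p ∈ tensorZPow U (m + N - C) := by
  rw [← LinearMap.sub_apply]
  refine map_mem_of_mem_tensorZPow _ (fun u hu a ha => ?_) hp
  rw [LinearMap.sub_apply, tmul_eq_scalarMul, scalarExtension_scalarMul, expSum_scalarMul,
    scalarExtension_tmul_one, ← map_sub]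
  have := scalarMul_mem_tensorZPow ha (hE u hu N)
  rwa [← add_sub_assoc] at this

/-- The binomial theorem for (-T + T)^n, divided by n!. -/
theorem sum_exp_mul_exp_neg {M : Type*} [AddCommGroup M] [Module ℂ M] (T : Module.End ℂ M)
    (n : ℕ) : ∑ i ∈ Finset.range (n + 1),
      (((n - i).factorial : ℂ)⁻¹ • T ^ (n - i)) * ((i.factorial : ℂ)⁻¹ • (-T) ^ i) =
        if n = 0 then 1 else 0 := by
  have h := (Commute.neg_left (Commute.refl T)).add_pow n
  rw [neg_add_cancel] at h
  have h0 : (0 : Module.End ℂ M) ^ n = if n = 0 then 1 else 0 := by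
    split_ifs with hn
    · rw [hn, pow_zero]
    · exact zero_pow hn
  have key : ∀ i ∈ Finset.range (n + 1),
      (((n - i).factorial : ℂ)⁻¹ • T ^ (n - i)) * ((i.factorial : ℂ)⁻¹ • (-T) ^ i) =
        (n.factorial : ℂ)⁻¹ • ((-T) ^ i * T ^ (n - i) * (n.choose i : Module.End ℂ M)) := by
    intro i hi
    have hi' : i ≤ n := Nat.lt_succ_iff.1 (Finset.mem_range.1 hi)
    have hc : Commute (T ^ (n - i)) ((-T) ^ i) :=
      ((Commute.neg_right (Commute.refl T)).pow_left _).pow_right _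
    have hch := Nat.choose_mul_factorial_mul_factorial hi'
    rw [smul_mul_smul_comm, hc.eq, ← nsmul_eq_mul', ← Nat.cast_smul_eq_nsmul ℂ, smul_smul, ← hch]
    congr 1
    have h1 : (i.factorial : ℂ) ≠ 0 := by exact_mod_cast i.factorial_ne_zero
    have h2 : ((n - i).factorial : ℂ) ≠ 0 := by exact_mod_cast (n - i).factorial_ne_zero
    have h3 : (n.choose i : ℂ) ≠ 0 := by exact_mod_cast (Nat.choose_pos hi').ne'
    push_cast
    field_simp
  rw [Finset.sum_congr rfl key, ← Finset.smul_sum, ← h, h0]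
  split_ifs with hn
  · simp [hn]
  · simp

/-- `exp Φ` and `exp (-Φ)` are inverse to each other. -/
theorem scalarExtension_exp_exp_neg {Φ E E' : V →ₗ[ℂ] V ⊗[ℂ] ℂ⸨X⸩}
    (h : ∀ w, ∃ U C, w ∈ U ∧ IsContractedBy Φ U C)
    (hE : ∀ U C, IsContractedBy Φ U C → ∀ w ∈ U, ∀ N : ℕ,
        E w - expSum Φ N (w ⊗ₜ 1) ∈ tensorZPow U (N - C))
    (hE' : ∀ U C, IsContractedBy (-Φ) U C → ∀ w ∈ U, ∀ N : ℕ,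
        E' w - expSum (-Φ) N (w ⊗ₜ 1) ∈ tensorZPow U (N - C))
    (p : V ⊗[ℂ] ℂ⸨X⸩) : scalarExtension E (scalarExtension E' p) = p := by
  induction p with
  | zero => simp
  | add p q hp hq => simp only [map_add, hp, hq]
  | tmul w a =>
    rw [scalarExtension_tmul, scalarExtension_scalarMul, tmul_eq_scalarMul w a]
    congr 1
    obtain ⟨U, C, hw, hU⟩ := h w
    -- Each of the two exponentials loses C.
    refine sub_eq_zero.1 (eq_zero_of_forall_mem_tensorZPow (2 * C) fun N => ?_)
    let s : ℕ → V ⊗[ℂ] ℂ⸨X⸩ := fun i =>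
      ((i.factorial : ℂ)⁻¹ • (-scalarExtension Φ) ^ i) (w ⊗ₜ[ℂ] (1 : ℂ⸨X⸩))
    have hs : ∀ i : ℕ, s i ∈ tensorZPow U (i - C) := fun i => by
      have := hU.neg.pow_mem w hw i
      rw [scalarExtension_neg] at this
      exact Submodule.smul_mem _ _ this
    have hsum : expSum (-Φ) (N + 1) (w ⊗ₜ 1) = ∑ i ∈ Finset.range (N + 1), s i := by
      rw [expSum_apply, scalarExtension_neg]
      rfl
    -- Truncating the product of the two series to the triangle i + j ≤ N leaves whole diagonals,
    -- all of which cancel except the zeroth.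
    have hdiag : ∑ i ∈ Finset.range (N + 1), expSum Φ (N + 1 - i) (s i) = w ⊗ₜ 1 := by
      have hflip := Finset.sum_range_diag_flip (N + 1) fun i j : ℕ =>
        ((j.factorial : ℂ)⁻¹ • (scalarExtension Φ ^ j) (s i))
      simp only [expSum_apply]
      rw [← hflip]
      have : ∀ n ∈ Finset.range (N + 1), ∑ i ∈ Finset.range (n + 1),
          (((n - i).factorial : ℂ)⁻¹ • (scalarExtension Φ ^ (n - i)) (s i)) =
            if n = 0 then w ⊗ₜ[ℂ] (1 : ℂ⸨X⸩) else 0 := fun n _ => by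
        have := LinearMap.congr_fun (sum_exp_mul_exp_neg (scalarExtension Φ) n)
          (w ⊗ₜ[ℂ] (1 : ℂ⸨X⸩))
        rw [LinearMap.sum_apply] at this
        refine this.trans ?_
        split_ifs <;> rfl
      rw [Finset.sum_congr rfl this]
      simp
    have e : scalarExtension E (E' w) - w ⊗ₜ 1 =
        scalarExtension E (E' w - expSum (-Φ) (N + 1) (w ⊗ₜ 1)) +
          ∑ i ∈ Finset.range (N + 1),
            (scalarExtension E (s i) - expSum Φ (N + 1 - i) (s i)) := by
      rw [Finset.sum_sub_distrib, hdiag, map_sub, hsum, map_sum]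
      abel
    rw [e]
    refine Submodule.add_mem _ ?_ (Submodule.sum_mem _ fun i hi => ?_)
    · have := scalarExtension_sub_expSum_mem (hE U C hU) (hE' U C hU.neg w hw (N + 1)) 0
      rw [expSum_zero, LinearMap.zero_apply, sub_zero] at this
      exact tensorZPow_mono le_top (by push_cast; lia) this
    · rw [Finset.mem_range] at hi
      have := scalarExtension_sub_expSum_mem (hE U C hU) (hs i) (N + 1 - i)
      exact tensorZPow_mono le_top (by lia) this

/-- The exponential of a derivation is a homomorphism. -/
theorem VertexData.exp_mode (A : VertexData V) {Φ E : V →ₗ[ℂ] V ⊗[ℂ] ℂ⸨X⸩}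
    (h : ∀ w, ∃ U C, w ∈ U ∧ IsContractedBy Φ U C)
    (hval : ∀ w, IsExpValue Φ w (E w))
    (hE : ∀ U C, IsContractedBy Φ U C → ∀ w ∈ U, ∀ N : ℕ,
        E w - expSum Φ N (w ⊗ₜ 1) ∈ tensorZPow U (N - C))
    (hΦ : ∀ (u w : V) (n : ℤ), Φ (A.mode u n w) =
      A.expMode laurentDerivation n (Φ u) (w ⊗ₜ 1) +
        A.expMode laurentDerivation n (u ⊗ₜ 1) (Φ w))
    (u w : V) (n : ℤ) :
    E (A.mode u n w) = A.expMode laurentDerivation n (E u) (E w) := by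
  obtain ⟨U, C, hu, hU⟩ := h u
  obtain ⟨W, C', hw, hW⟩ := h w
  obtain ⟨B, hB⟩ := A.exists_expMode_mem_tensorZPow n hU.fg hW.fg
  -- C and C' come from the two series, B from the continuity of the n-th product.
  refine (hval _).unique ⟨C + C' + B, fun N => ?_⟩
  let s : ℕ → V ⊗[ℂ] ℂ⸨X⸩ := fun i =>
    (i.factorial : ℂ)⁻¹ • (scalarExtension Φ ^ i) (u ⊗ₜ[ℂ] (1 : ℂ⸨X⸩))
  have hs : ∀ i : ℕ, s i ∈ tensorZPow U (i - C) := fun i =>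
    Submodule.smul_mem _ _ (hU.pow_mem u hu i)
  have h1 : A.mode u n w ⊗ₜ[ℂ] (1 : ℂ⸨X⸩) =
      A.expMode laurentDerivation n (u ⊗ₜ 1) (w ⊗ₜ 1) := by
    rw [A.expMode_tmul, finsum_nat_eq_sum_range (K := 1)]
    · simp [dividedPower_zero]
    · intro j hj
      rw [dividedPower_one, if_neg (by lia)]
      simp
  have hdiag : expSum Φ N (A.mode u n w ⊗ₜ 1) = ∑ i ∈ Finset.range N,
      A.expMode laurentDerivation n (s i) (expSum Φ (N - i) (w ⊗ₜ 1)) := by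
    rw [h1, expSum_apply]
    simp only [A.scalarExtension_pow_expMode laurentDerivation hΦ]
    rw [Finset.sum_range_diag_flip N fun i j : ℕ => A.expMode laurentDerivation n
      ((i.factorial : ℂ)⁻¹ • (scalarExtension Φ ^ i) (u ⊗ₜ[ℂ] (1 : ℂ⸨X⸩)))
      ((j.factorial : ℂ)⁻¹ • (scalarExtension Φ ^ j) (w ⊗ₜ[ℂ] (1 : ℂ⸨X⸩)))]
    refine Finset.sum_congr rfl fun i _ => ?_
    rw [expSum_apply, map_sum]
  -- The i-th term for u is paired with a tail for w starting at N - i, so every summand has order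
  -- at least N up to the constant.
  have e : A.expMode laurentDerivation n (E u) (E w) - expSum Φ N (A.mode u n w ⊗ₜ 1) =
      A.expMode laurentDerivation n (E u - expSum Φ N (u ⊗ₜ 1)) (E w) +
        ∑ i ∈ Finset.range N,
          A.expMode laurentDerivation n (s i) (E w - expSum Φ (N - i) (w ⊗ₜ 1)) := by
    simp only [map_sub, LinearMap.sub_apply, Finset.sum_sub_distrib]
    rw [hdiag, expSum_apply Φ N (u ⊗ₜ 1), map_sum, LinearMap.sum_apply]
    abel
  rw [e]
  refine Submodule.add_mem _ ?_ (Submodule.sum_mem _ fun i hi => ?_)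
  · have := hE W C' hW w hw 0
    rw [expSum_zero, LinearMap.zero_apply, sub_zero] at this
    exact tensorZPow_mono le_rfl (by push_cast; lia)
      (hB _ _ _ (hE U C hU u hu N) _ this)
  · rw [Finset.mem_range] at hi
    exact tensorZPow_mono le_rfl (by lia)
      (hB _ _ _ (hs i) _ (hE W C' hW w hw (N - i)))

theorem exp_eq_of_apply_eq_zero {Φ E : V →ₗ[ℂ] V ⊗[ℂ] ℂ⸨X⸩}
    (hval : ∀ w, IsExpValue Φ w (E w)) {w : V} (hw : Φ w = 0) : E w = w ⊗ₜ 1 := by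
  refine (hval w).unique ⟨0, fun N => ?_⟩
  cases N with
  | zero =>
    rw [expSum_zero, LinearMap.zero_apply, sub_zero]
    exact tmul_mem_tensorZPow Submodule.mem_top (by simpa using one_mem_zPowSubspace)
  | succ N =>
    have : expSum Φ (N + 1) (w ⊗ₜ 1) = w ⊗ₜ 1 := by
      rw [expSum_apply, Finset.sum_range_succ', Finset.sum_eq_zero]
      · simp
      · intro i _
        rw [pow_succ, Module.End.mul_apply, scalarExtension_tmul_one, hw, map_zero, smul_zero]
    rw [this, sub_self]
    exact Submodule.zero_mem _

/-- The exponential of a locally contracted derivation is a pseudo-automorphism. -/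
theorem VertexData.exists_isFormalExp_isPseudoAutomorphism (A : VertexData V)
    {Φ : V →ₗ[ℂ] V ⊗[ℂ] ℂ⸨X⸩} (h : ∀ w, ∃ U C, w ∈ U ∧ IsContractedBy Φ U C)
    (hvac : Φ A.vac = 0)
    (hΦ : ∀ (u w : V) (n : ℤ), Φ (A.mode u n w) =
      A.expMode laurentDerivation n (Φ u) (w ⊗ₜ 1) +
        A.expMode laurentDerivation n (u ⊗ₜ 1) (Φ w)) :
    ∃ E : V →ₗ[ℂ] V ⊗[ℂ] ℂ⸨X⸩,
      IsFormalExp Φ E ∧ A.IsPseudoAutomorphism laurentDerivation E := by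
  have h' : ∀ w, ∃ U C, w ∈ U ∧ IsContractedBy (-Φ) U C := fun w => by
    obtain ⟨U, C, hw, hU⟩ := h w
    exact ⟨U, C, hw, hU.neg⟩
  obtain ⟨E, hval, hE⟩ := exists_formalExp h
  obtain ⟨E', -, hE'⟩ := exists_formalExp h'
  have hmode := A.exp_mode h hval hE hΦ
  have hEvac : E A.vac = A.vac ⊗ₜ 1 := exp_eq_of_apply_eq_zero hval hvac
  refine ⟨E, fun w => ?_, ⟨hEvac, hmode⟩, ?_, ?_, fun p q n => ?_⟩
  · obtain ⟨U, C, hw, hU⟩ := h w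
    refine ⟨U, Module.Finite.iff_fg.2 hU.fg, fun M => ⟨(M + C).toNat, fun N hN => ?_⟩⟩
    have := hE U C hU w hw N
    rw [expSum_apply] at this
    exact tensorZPow_mono le_rfl (by lia) this
  · refine Function.bijective_iff_has_inverse.2 ⟨scalarExtension E', fun p => ?_, fun p => ?_⟩
    -- The same result for -Φ gives the other composite.
    · refine scalarExtension_exp_exp_neg h' hE' ?_ p
      simpa only [neg_neg] using hE
    · exact scalarExtension_exp_exp_neg h hE hE' p
  · exact (scalarExtension_tmul_one E A.vac).trans hEvac
  · rw [A.tensor_mode, A.tensor_mode]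
    exact A.scalarExtension_expMode laurentDerivation hmode n p q

end FormalExp

/-! ### Commuting locally finite operators -/

section LocallyFinite

variable {V : Type*} [AddCommGroup V] [Module ℂ V]

theorem IsLocallyFiniteOperator.exists_fg_le {T : Module.End ℂ V} (hT : IsLocallyFiniteOperator T)
    {W : Submodule ℂ V} (hW : W.FG) : ∃ Z : Submodule ℂ V, Z.FG ∧ W ≤ Z ∧ Z ≤ Z.comap T := by
  induction W, hW using Submodule.fg_induction with
  | singleton x =>
    obtain ⟨U, hU, hx, hTU⟩ := hT x
    exact ⟨U, Module.Finite.iff_fg.1 hU, by simpa using hx, hTU⟩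
  | sup W₁ W₂ _ _ h₁ h₂ =>
    obtain ⟨Z₁, hf₁, hl₁, ht₁⟩ := h₁
    obtain ⟨Z₂, hf₂, hl₂, ht₂⟩ := h₂
    refine ⟨Z₁ ⊔ Z₂, hf₁.sup hf₂, sup_le_sup hl₁ hl₂, sup_le ?_ ?_⟩
    · exact ht₁.trans (Submodule.comap_mono le_sup_left)
    · exact ht₂.trans (Submodule.comap_mono le_sup_right)

/-- A finite-dimensional subspace generates a finite-dimensional invariant one under a locally
finite operator, and this preserves invariance under commuting operators. -/
theorem IsLocallyFiniteOperator.exists_invariant {T : Module.End ℂ V}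
    (hT : IsLocallyFiniteOperator T) {W : Submodule ℂ V} (hW : W.FG) :
    ∃ W' : Submodule ℂ V, W'.FG ∧ W ≤ W' ∧ W' ≤ W'.comap T ∧
      ∀ S : Module.End ℂ V, Commute S T → W ≤ W.comap S → W' ≤ W'.comap S := by
  obtain ⟨Z, hZ, hWZ, hTZ⟩ := hT.exists_fg_le hW
  -- Z only bounds the dimension; it is the span of the T^n W that inherits invariance under
  -- operators commuting with T.
  refine ⟨⨆ n : ℕ, W.map (T ^ n), ?_, ?_, ?_, fun S hS hWS => ?_⟩
  · have hle : ⨆ n : ℕ, W.map (T ^ n) ≤ Z := by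
      refine iSup_le fun n => Submodule.map_le_iff_le_comap.2 fun x hx => ?_
      rw [Submodule.mem_comap]
      induction n with
      | zero => simpa using hWZ hx
      | succ n ih =>
        rw [pow_succ', Module.End.mul_apply]
        exact hTZ ih
    have : FiniteDimensional ℂ Z := Module.Finite.iff_fg.2 hZ
    exact Module.Finite.iff_fg.1 (Submodule.finiteDimensional_of_le hle)
  · exact le_trans (by simp [Submodule.map_id, Module.End.one_eq_id])
      (le_iSup (fun n : ℕ => W.map (T ^ n)) 0)
  · refine iSup_le fun n => ?_
    rintro _ ⟨x, hx, rfl⟩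
    rw [Submodule.mem_comap, ← Module.End.mul_apply, ← pow_succ']
    exact Submodule.mem_iSup_of_mem (n + 1) (Submodule.mem_map_of_mem hx)
  · refine iSup_le fun n => ?_
    rintro _ ⟨x, hx, rfl⟩
    rw [Submodule.mem_comap, ← Module.End.mul_apply, (hS.pow_right n).eq, Module.End.mul_apply]
    exact Submodule.mem_iSup_of_mem n (Submodule.mem_map_of_mem (hWS hx))

end LocallyFinite

/-! ### Weights -/

namespace VertexOperatorAlgebra

variable {V : Type*} [AddCommGroup V] [Module ℂ V] (A : VertexOperatorAlgebra V)

/-- The commutator formula for ω_1 gives [L(0), v_n] = (L(-1)v)_{n+1} + (L(0)v)_n = (k - n - 1) v_n.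
-/
theorem mode_mem_weightSpace {k h : ℤ} {v w : V} (hv : v ∈ A.weightSpace k)
    (hw : w ∈ A.weightSpace h) (n : ℤ) : A.mode v n w ∈ A.weightSpace (h + k - n - 1) := by
  have hv' : A.mode A.conf 1 v = (k : ℂ) • v := Module.End.mem_eigenspace_iff.1 hv
  have hw' : A.mode A.conf 1 w = (h : ℂ) • w := Module.End.mem_eigenspace_iff.1 hw
  have hc := A.mode_mode_sub A.conf v w 1 n
  simp only [Finset.sum_range_succ, Finset.sum_range_zero, Nat.cast_zero, Nat.cast_one,
    Nat.choose_self, Nat.choose_zero_right, one_smul, zero_add, hv', A.translation, hw',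
    A.mode_smul, LinearMap.smul_apply, map_smul, sub_zero] at hc
  rw [show (1 : ℤ) + n - 1 = n by ring] at hc
  refine Module.End.mem_eigenspace_iff.2 ?_
  rw [sub_eq_iff_eq_add.1 hc, ← add_smul, ← add_smul]
  congr 1
  push_cast
  ring

/-- The sum of the weight spaces of weight at most `H`. -/
def weightLE (H : ℤ) : Submodule ℂ V := ⨆ h : Set.Iic H, A.weightSpace h

theorem weightSpace_le_weightLE {h H : ℤ} (hh : h ≤ H) : A.weightSpace h ≤ A.weightLE H :=
  le_iSup (fun h : Set.Iic H => A.weightSpace h) ⟨h, hh⟩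

theorem weightLE_mono {H H' : ℤ} (h : H ≤ H') : A.weightLE H ≤ A.weightLE H' :=
  iSup_le fun i => A.weightSpace_le_weightLE (le_trans i.2 h)

theorem exists_mem_weightLE (w : V) : ∃ H, w ∈ A.weightLE H := by
  have hw : w ∈ ⨆ n : ℤ, A.weightSpace n := by
    have := A.grading.submodule_iSup_eq_top
    exact this ▸ Submodule.mem_top
  refine Submodule.iSup_induction A.weightSpace (motive := fun w => ∃ H, w ∈ A.weightLE H) hw
    (fun i x hx => ⟨i, A.weightSpace_le_weightLE le_rfl hx⟩) ⟨0, Submodule.zero_mem _⟩ ?_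
  rintro x y ⟨H, hH⟩ ⟨H', hH'⟩
  exact ⟨max H H', Submodule.add_mem _ (A.weightLE_mono (le_max_left _ _) hH)
    (A.weightLE_mono (le_max_right _ _) hH')⟩

theorem exists_le_weightLE {U : Submodule ℂ V} (hU : U.FG) : ∃ H, U ≤ A.weightLE H := by
  induction U, hU using Submodule.fg_induction with
  | singleton x =>
    obtain ⟨H, hH⟩ := A.exists_mem_weightLE x
    exact ⟨H, by simpa using hH⟩
  | sup W₁ W₂ _ _ h₁ h₂ =>
    obtain ⟨H, hH⟩ := h₁
    obtain ⟨H', hH'⟩ := h₂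
    exact ⟨max H H', sup_le (hH.trans (A.weightLE_mono (le_max_left _ _)))
      (hH'.trans (A.weightLE_mono (le_max_right _ _)))⟩

theorem weightLE_fg (H : ℤ) : (A.weightLE H).FG := by
  obtain ⟨N, hN⟩ := A.bounded_below
  have hle : A.weightLE H ≤ ⨆ h ∈ Finset.Icc N H, A.weightSpace h := by
    refine iSup_le fun h => ?_
    by_cases hh : (h : ℤ) < N
    · have h0 : A.weightSpace h = ⊥ := hN h hh
      rw [h0]
      exact bot_le
    · exact le_iSup₂_of_le (h : ℤ) (Finset.mem_Icc.2 ⟨not_lt.1 hh, h.2⟩) le_rfl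
  have hfg : (⨆ h ∈ Finset.Icc N H, A.weightSpace h).FG :=
    Submodule.fg_biSup _ _ fun h _ => Module.Finite.iff_fg.1 (A.finiteDimensional h)
  have : FiniteDimensional ℂ ↥(⨆ h ∈ Finset.Icc N H, A.weightSpace h) :=
    Module.Finite.iff_fg.2 hfg
  exact Module.Finite.iff_fg.1 (Submodule.finiteDimensional_of_le hle)

/-- Under the commutativity and local finiteness hypotheses, every vector lies in a
finite-dimensional subspace that is stable under all `v_n` with `n ≥ 0`. -/
theorem exists_fg_invariant {k : ℕ} {v : V} (hv : v ∈ A.weightSpace k)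
    (hcomm : ∀ m n : ℕ, ⁅A.mode v m, A.mode v n⁆ = 0)
    (hfin : ∀ i : ℕ, i < k → IsLocallyFiniteOperator (A.mode v i)) (w : V) :
    ∃ U : Submodule ℂ V, U.FG ∧ w ∈ U ∧ ∀ n : ℕ, U ≤ U.comap (A.mode v n) := by
  -- The modes with n ≥ k come first because their stability is free from weights; the induction
  -- then adjoins v_j.
  have key : ∀ j ≤ k, ∃ U : Submodule ℂ V, U.FG ∧ w ∈ U ∧
      ∀ n : ℕ, n < j ∨ k ≤ n → U ≤ U.comap (A.mode v n) := by
    intro j hj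
    induction j with
    | zero =>
      obtain ⟨H, hH⟩ := A.exists_mem_weightLE w
      refine ⟨A.weightLE H, A.weightLE_fg H, hH, fun n hn => iSup_le fun h x hx => ?_⟩
      have hh : (h : ℤ) ≤ H := h.2
      exact A.weightSpace_le_weightLE (by lia) (A.mode_mem_weightSpace hv hx n)
    | succ j ih =>
      obtain ⟨U, hU, hw, hinv⟩ := ih (by lia)
      obtain ⟨U', hU', hle, hT, hS⟩ := (hfin j (by lia)).exists_invariant hU
      refine ⟨U', hU', hle hw, fun n hn => ?_⟩
      by_cases hnj : n = j
      · exact hnj ▸ hT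
      · exact hS _ (sub_eq_zero.1 (hcomm n j)) (hinv n (by lia))
  obtain ⟨U, hU, hw, hinv⟩ := key k le_rfl
  exact ⟨U, hU, hw, fun n => hinv n (by lia)⟩

/-- The span of the `u ⊗ a` with `u` of weight `h` and `a` of `z`-adic order at least `h + N`. -/
noncomputable def weightFiltration (N : ℤ) : Submodule ℂ (V ⊗[ℂ] ℂ⸨X⸩) :=
  ⨆ h : ℤ, tensorZPow (A.weightSpace h) (h + N)

theorem exists_weightFiltration_le : ∃ B : ℤ, ∀ N, A.weightFiltration N ≤ tensorZPow ⊤ (N + B) := by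
  obtain ⟨B, hB⟩ := A.bounded_below
  refine ⟨B, fun N => iSup_le fun h => ?_⟩
  by_cases hh : h < B
  · have h0 : A.weightSpace h = ⊥ := hB h hh
    rw [h0]
    exact (Submodule.map₂_bot_left _ _).trans_le bot_le
  · exact tensorZPow_mono le_top (by lia)

theorem tmul_one_mem_weightFiltration {H : ℤ} {u : V} (hu : u ∈ A.weightLE H) :
    u ⊗ₜ 1 ∈ A.weightFiltration (-H) := by
  have hle : A.weightLE H ≤
      (A.weightFiltration (-H)).comap ((TensorProduct.mk ℂ V ℂ⸨X⸩).flip 1) := by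
    refine iSup_le fun h x hx => Submodule.mem_iSup_of_mem (h : ℤ) ?_
    have hh : (h : ℤ) ≤ H := h.2
    exact tmul_mem_tensorZPow hx (zPowSubspace_anti (by lia) one_mem_zPowSubspace)
  exact hle hu

/-- The j-th summand adds k - j - 1 to the weight and at least k - j to the order: a gain of one,
whatever j is. -/
theorem scalarExtension_pseudoDer_mem_weightFiltration {k : ℤ} {v : V}
    (hv : v ∈ A.weightSpace k) {f : ℂ⸨X⸩} (hf : f ∈ zPowSubspace k) {N : ℤ}
    {p : V ⊗[ℂ] ℂ⸨X⸩} (hp : p ∈ A.weightFiltration N) :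
    scalarExtension (A.pseudoDer laurentDerivation v f) p ∈ A.weightFiltration (N + 1) := by
  have hle : A.weightFiltration N ≤ (A.weightFiltration (N + 1)).comap
      (scalarExtension (A.pseudoDer laurentDerivation v f)) := by
    refine iSup_le fun h q hq => Submodule.mem_comap.2 (map_mem_of_mem_tensorZPow
      (scalarExtension (A.pseudoDer laurentDerivation v f)) (fun u hu a ha => ?_) hq)
    obtain ⟨K, hK⟩ := A.exists_mode_eq_zero v u
    rw [scalarExtension_tmul, A.pseudoDer_eq_sum laurentDerivation v f u (K := K.toNat)
      fun m hm => hK m (by lia), map_sum]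
    refine Submodule.sum_mem _ fun j _ => Submodule.mem_iSup_of_mem (h + k - j - 1) ?_
    rw [scalarMul_tmul]
    refine tmul_mem_tensorZPow (A.mode_mem_weightSpace hv hu j) ?_
    exact zPowSubspace_anti (by lia)
      (mul_mem_zPowSubspace ha (dividedPower_mem_zPowSubspace hf j))
  exact hle hp

/-- Only modes v_j with j ≥ 0 enter, so U ⊗ ℂ((z)) is stable. -/
theorem scalarExtension_pseudoDer_pow_mem_map₂_top {v : V} (f : ℂ⸨X⸩) {U : Submodule ℂ V}
    (hU : ∀ n : ℕ, U ≤ U.comap (A.mode v n)) {u : V} (hu : u ∈ U) (n : ℕ) :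
    (scalarExtension (A.pseudoDer laurentDerivation v f) ^ n) (u ⊗ₜ 1) ∈
      Submodule.map₂ (TensorProduct.mk ℂ V ℂ⸨X⸩) U ⊤ := by
  induction n with
  | zero => exact Submodule.apply_mem_map₂ _ hu Submodule.mem_top
  | succ n ih =>
    rw [pow_succ', Module.End.mul_apply]
    have hle : Submodule.map₂ (TensorProduct.mk ℂ V ℂ⸨X⸩) U ⊤ ≤
        (Submodule.map₂ (TensorProduct.mk ℂ V ℂ⸨X⸩) U ⊤).comap
          (scalarExtension (A.pseudoDer laurentDerivation v f)) := by
      refine Submodule.map₂_le.2 fun x hx a _ => ?_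
      obtain ⟨K, hK⟩ := A.exists_mode_eq_zero v x
      rw [Submodule.mem_comap, TensorProduct.mk_apply, scalarExtension_tmul,
        A.pseudoDer_eq_sum laurentDerivation v f x (K := K.toNat) fun m hm => hK m (by lia),
        map_sum]
      refine Submodule.sum_mem _ fun j _ => ?_
      rw [scalarMul_tmul]
      exact Submodule.apply_mem_map₂ (TensorProduct.mk ℂ V ℂ⸨X⸩) (hU j hx) Submodule.mem_top
    exact hle ih

theorem exists_isContractedBy_pseudoDer {k : ℕ} {v : V} (hv : v ∈ A.weightSpace k)
    (hcomm : ∀ m n : ℕ, ⁅A.mode v m, A.mode v n⁆ = 0)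
    (hfin : ∀ i : ℕ, i < k → IsLocallyFiniteOperator (A.mode v i))
    {f : ℂ⸨X⸩} (hf : f ∈ zPowSubspace k) (w : V) :
    ∃ U C, w ∈ U ∧ IsContractedBy (A.pseudoDer laurentDerivation v f) U C := by
  obtain ⟨U, hU, hw, hinv⟩ := A.exists_fg_invariant hv hcomm hfin w
  obtain ⟨H, hH⟩ := A.exists_le_weightLE hU
  obtain ⟨B, hB⟩ := A.exists_weightFiltration_le
  -- u ⊗ 1 starts at level -H, n steps reach n - H, and the lower weight bound B turns this into
  -- order n - H + B.
  refine ⟨U, H - B, hw, hU, fun u hu n => mem_tensorZPow_of_mem_map₂_top ?_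
    (A.scalarExtension_pseudoDer_pow_mem_map₂_top f hinv hu n)⟩
  have hpow : (scalarExtension (A.pseudoDer laurentDerivation v f) ^ n) (u ⊗ₜ 1) ∈
      A.weightFiltration (-H + n) := by
    induction n with
    | zero => simpa using A.tmul_one_mem_weightFiltration (hH hu)
    | succ n ih =>
      rw [pow_succ', Module.End.mul_apply]
      have := A.scalarExtension_pseudoDer_mem_weightFiltration hv hf ih
      rwa [show -H + ((n + 1 : ℕ) : ℤ) = -H + n + 1 by push_cast; ring]
  exact tensorZPow_mono le_rfl (by lia) (hB _ hpow)

end VertexOperatorAlgebra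

theorem proposition3p13 {V : Type*} [AddCommGroup V] [Module ℂ V] (A : VertexOperatorAlgebra V)
    (k : ℕ) (hk : 0 < k) (v : V) (hv : v ∈ A.weightSpace k)
    (hcomm : ∀ m n : ℕ, ⁅A.mode v m, A.mode v n⁆ = 0)
    (hfin : ∀ i : ℕ, i < k → IsLocallyFiniteOperator (A.mode v i))
    (f : ℂ⸨X⸩) (hf : f ∈ zPowSubspace k) :
    ∃ E : V →ₗ[ℂ] V ⊗[ℂ] ℂ⸨X⸩,
      IsFormalExp (A.pseudoDer laurentDerivation v f) E ∧
        A.IsPseudoAutomorphism laurentDerivation E :=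
  A.exists_isFormalExp_isPseudoAutomorphism
    (A.exists_isContractedBy_pseudoDer hv hcomm hfin hf)
    (A.pseudoDer_vac laurentDerivation v f) (A.pseudoDer_mode laurentDerivation v f)
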